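/- Let $X$ be a complex Banach space and let $A$, $B$ be bounded linear operators on $X$, with spectra $\sigma(A)$ and $\sigma(B)$. Write $[S,T] = ST - TS$. (1) Let $U_A, U_B \subseteq \mathbb{C}$ be open sets with $\sigma(A) \subseteq U_A$ and $\sigma(B) \subseteq U_B$, and let $f, g : \mathbb{C} \to \mathbb{C}$ be functions such that $f$ is holomorphic and injective on $U_A$ and $g$ is holomorphic and injective on $U_B$. Then $[f(A), g(B)] = 0$ if and only if $[A, B] = 0$. Here $f(A)$ is given by the holomorphic functional calculus, $f(A) = \frac{1}{2\pi i} \oint_{\Gamma} f(z) (z - A)^{-1}\, dz$, where $\Gamma$ is any polygonal cycle in $U_A \setminus \sigma(A)$ with index $1$ about every point of $\sigma(A)$ and index $0$ about every point of $\mathbb{C} \setminus U_A$; the operator $g(B)$ is defined in the same way. (2) Suppose that $\sigma(A)$ is $2\pi i$-congruence free, i.e. there are no $\lambda_1, \lambda_2 \in \sigma(A)$ with $\lambda_1 - \lambda_2 = 2k\pi i$ for some $k \in \mathbb{Z} \setminus \{0\}$. Then $[e^A, B] = 0$ if and only if $[A, B] = 0$, where $e^A = \sum_{n \ge 0} A^n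 / n!$. -/

import Mathlib

namespace HolFC

/-- The set `S` is `w`-congruence free: no two different points of `S` differ by an integer
multiple of `w`. -/
def CongruenceFree (w : ℂ) (S : Set ℂ) : Prop :=
  ∀ z₁ ∈ S, ∀ z₂ ∈ S, z₁ ≠ z₂ → ∀ k : ℤ, z₁ - z₂ ≠ (k : ℂ) * w

/-- A polygonal chain: a finite list of oriented segments; `(a, b)` is the segment from `a`
to `b`. -/
abbrev Chain : Type := List (ℂ × ℂ)

/-- The integral of `F` along the oriented segment from `s.1` to `s.2`, parametrized by
`t ↦ s.1 + t (s.2 - s.1)` on `[0, 1]`. -/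
noncomputable def segIntegral {E : Type*} [NormedAddCommGroup E] [NormedSpace ℂ E]
    (F : ℂ → E) (s : ℂ × ℂ) : E :=
  (s.2 - s.1) • ∫ t in (0 : ℝ)..1, F (s.1 + (t : ℂ) * (s.2 - s.1))

/-- The integral of `F` along a chain. -/
noncomputable def chainIntegral {E : Type*} [NormedAddCommGroup E] [NormedSpace ℂ E]
    (F : ℂ → E) (Γ : Chain) : E :=
  (Γ.map (segIntegral F)).sum

/-- The index (winding number) of a chain about `z`. -/
noncomputable def index (Γ : Chain) (z : ℂ) : ℂ :=
  (2 * (Real.pi : ℂ) * Complex.I)⁻¹ * chainIntegral (fun ζ => (ζ - z)⁻¹) Γ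

/-- `Γ` is a contour that surrounds `K` in `U`: a polygonal cycle in `U \ K` whose index is `1`
about every point of `K` and `0` about every point outside `U`. -/
structure Surrounds (Γ : Chain) (K U : Set ℂ) : Prop where
  /-- Every point is as often the initial point of a segment as it is an end point. -/
  isCycle : (Γ.map Prod.fst).Perm (Γ.map Prod.snd)
  subset : ∀ s ∈ Γ, segment ℝ s.1 s.2 ⊆ U \ K
  index_eq_one : ∀ z ∈ K, index Γ z = 1
  index_eq_zero : ∀ z ∉ U, index Γ z = 0

variable {X : Type*} [NormedAddCommGroup X] [NormedSpace ℂ X]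

/-- The Cauchy integral `(2πi)⁻¹ ∮_Γ f(z) (z - A)⁻¹ dz`. -/
noncomputable def cauchyIntegral (f : ℂ → ℂ) (A : X →L[ℂ] X) (Γ : Chain) : X →L[ℂ] X :=
  (2 * (Real.pi : ℂ) * Complex.I)⁻¹ • chainIntegral (fun z => f z • resolvent A z) Γ

open Classical in
/-- The operator `f(A)` of the holomorphic functional calculus, for `f` holomorphic on the open
set `U` that contains the spectrum of `A`: the Cauchy integral along a contour surrounding the
spectrum of `A` in `U`. (Such a contour always exists when `U` is open and contains the spectrum,
and the operator does not depend on it.) -/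
noncomputable def holFC (f : ℂ → ℂ) (U : Set ℂ) (A : X →L[ℂ] X) : X →L[ℂ] X :=
  if h : ∃ Γ : Chain, Surrounds Γ (spectrum ℂ A) U then cauchyIntegral f A h.choose else 0

end HolFC

/-! Write `f(A)` as a contour integral of resolvents. Whatever commutes with `A` commutes with its
resolvents, hence with `f(A)`. The converse needs a way to recover `A` from `f(A)`. For injective
`f`, the inverse function is given by Lagrange's integral z = (2πi)⁻¹ ∮_Δ ζ f'(ζ) (f(ζ) - f(z))⁻¹
dζ, with Δ surrounding the contour Γ on which z runs. Integrating this against the resolvent along Γ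
and applying Fubini gives A = (2πi)⁻¹ ∮_Δ ζ f'(ζ) (f(ζ) - f(A))⁻¹ dζ. An operator that commutes with
`f(A)` commutes with each inverse under the integral, hence with `A` (`commute_of_commute_holInt`).
So `A` and `f(A)` have the same commutant; using this for `f(A)` and then for `g(B)` gives (1).

For (2), congruence freeness says that `exp` is injective on the compact spectrum. As `exp` is also
locally injective, it is injective on a neighbourhood (`exists_isOpen_injOn_exp`), and the calculus
of `exp` is the exponential series (`holInt_exp`).

The functional calculus is built from scratch on polygonal cycles. Grid squares give contours around
compact sets (`exists_grid_cycle`). These yield the homology form of Cauchy's theorem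
(`chainIntegral_eq_zero`), and from it come multiplicativity (`holInt_mul`) and the normalizations
`holInt_const` and `holInt_id`. A recurring device is the compact set `hull Γ` and a second contour
Δ around it: the two traces are disjoint, so Fubini applies to kernels singular on the diagonal. -/

namespace HolFC
open Set

/-! ### Integration along polygonal chains -/

section Chains
variable {E F : Type*} [NormedAddCommGroup E] [NormedSpace ℂ E]
  [NormedAddCommGroup F] [NormedSpace ℂ F]

/-- The set of points on the segments of a chain. -/
def trace (Γ : Chain) : Set ℂ := {w | ∃ s ∈ Γ, w ∈ segment ℝ s.1 s.2}

/-- Every point is as often the initial point of a segment of `Γ` as it is an end point. -/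
def IsCycle (Γ : Chain) : Prop := (Γ.map Prod.fst).Perm (Γ.map Prod.snd)

lemma segment_subset_trace {Γ : Chain} {s : ℂ × ℂ} (hs : s ∈ Γ) :
    segment ℝ s.1 s.2 ⊆ trace Γ := fun _ hw => ⟨s, hs, hw⟩

lemma trace_append (Γ Δ : Chain) : trace (Γ ++ Δ) = trace Γ ∪ trace Δ := by
  ext w
  simp only [trace, List.mem_append, mem_ofPred_eq, mem_union]
  grind

lemma trace_eq_biUnion (Γ : Chain) : trace Γ = ⋃ s ∈ Γ.toFinset, segment ℝ s.1 s.2 := by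
  ext w
  simp [trace]

lemma isCompact_trace (Γ : Chain) : IsCompact (trace Γ) := by
  rw [trace_eq_biUnion]
  refine Γ.toFinset.isCompact_biUnion fun s _ => ?_
  rw [segment_eq_image_lineMap]
  exact isCompact_Icc.image AffineMap.lineMap_continuous

lemma isClosed_trace (Γ : Chain) : IsClosed (trace Γ) := (isCompact_trace Γ).isClosed

lemma point_mem_segment (s : ℂ × ℂ) {t : ℝ} (ht : t ∈ Icc (0 : ℝ) 1) :
    s.1 + (t : ℂ) * (s.2 - s.1) ∈ segment ℝ s.1 s.2 := by
  rw [segment_eq_image']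
  exact ⟨t, ht, by simp⟩

lemma continuousOn_comp_point {E : Type*} [NormedAddCommGroup E] {f : ℂ → E} {s : ℂ × ℂ} (hf : ContinuousOn f (segment ℝ s.1 s.2)) :
    ContinuousOn (fun t : ℝ => f (s.1 + (t : ℂ) * (s.2 - s.1))) (uIcc 0 1) := by
  refine hf.comp (by fun_prop) fun t ht => point_mem_segment s ?_
  rwa [uIcc_of_le zero_le_one] at ht

lemma intervalIntegrable_point {E : Type*} [NormedAddCommGroup E] {f : ℂ → E} {s : ℂ × ℂ}
    (hf : ContinuousOn f (segment ℝ s.1 s.2)) :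
    IntervalIntegrable (fun t : ℝ => f (s.1 + (t : ℂ) * (s.2 - s.1))) MeasureTheory.volume 0 1 :=
  (continuousOn_comp_point hf).intervalIntegrable

lemma segIntegral_congr {f g : ℂ → E} {s : ℂ × ℂ} (h : EqOn f g (segment ℝ s.1 s.2)) :
    segIntegral f s = segIntegral g s := by
  unfold segIntegral
  congr 1
  refine intervalIntegral.integral_congr fun t ht => h (point_mem_segment s ?_)
  rwa [uIcc_of_le zero_le_one] at ht

lemma segIntegral_add {f g : ℂ → E} {s : ℂ × ℂ} (hf : ContinuousOn f (segment ℝ s.1 s.2))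
    (hg : ContinuousOn g (segment ℝ s.1 s.2)) :
    segIntegral (fun z => f z + g z) s = segIntegral f s + segIntegral g s := by
  unfold segIntegral
  rw [intervalIntegral.integral_add (intervalIntegrable_point hf) (intervalIntegrable_point hg),
    smul_add]

lemma segIntegral_smul (c : ℂ) (f : ℂ → E) (s : ℂ × ℂ) :
    segIntegral (fun z => c • f z) s = c • segIntegral f s := by
  unfold segIntegral
  rw [intervalIntegral.integral_smul, smul_comm]

lemma segIntegral_clm [CompleteSpace E] [CompleteSpace F] (L : E →L[ℂ] F) {f : ℂ → E} {s : ℂ × ℂ}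
    (hf : ContinuousOn f (segment ℝ s.1 s.2)) :
    segIntegral (fun z => L (f z)) s = L (segIntegral f s) := by
  unfold segIntegral
  rw [L.intervalIntegral_comp_comm (intervalIntegrable_point hf), map_smul]

lemma segIntegral_swap (f : ℂ → E) (s : ℂ × ℂ) :
    segIntegral f s.swap = -segIntegral f s := by
  unfold segIntegral
  have h := intervalIntegral.integral_comp_sub_left (a := 0) (b := 1)
    (fun t : ℝ => f (s.1 + (t : ℂ) * (s.2 - s.1))) 1
  simp only [sub_self, sub_zero] at h
  rw [← h, ← neg_smul, neg_sub]
  simp only [Prod.fst_swap, Prod.snd_swap]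
  congr 2
  ext t
  congr 1
  push_cast
  ring

lemma segIntegral_eq_sub [CompleteSpace E] {f g : ℂ → E} {s : ℂ × ℂ}
    (hf : ContinuousOn f (segment ℝ s.1 s.2))
    (hg : ∀ w ∈ segment ℝ s.1 s.2, HasDerivAt g (f w) w) :
    segIntegral f s = g s.2 - g s.1 := by
  unfold segIntegral
  rw [← intervalIntegral.integral_smul]
  have := intervalIntegral.integral_eq_sub_of_hasDerivAt (a := 0) (b := 1)
    (f := fun t : ℝ => g (s.1 + (t : ℂ) * (s.2 - s.1)))
    (f' := fun t : ℝ => (s.2 - s.1) • f (s.1 + (t : ℂ) * (s.2 - s.1))) ?_ ?_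
  · rw [this]; simp
  · intro t ht
    rw [uIcc_of_le zero_le_one] at ht
    have h1 : HasDerivAt (fun t : ℝ => s.1 + (t : ℂ) * (s.2 - s.1)) (s.2 - s.1) t := by
      simpa using ((Complex.ofRealCLM.hasDerivAt (x := t)).mul_const (s.2 - s.1)).const_add s.1
    exact (hg _ (point_mem_segment s ht)).scomp t h1
  · exact (intervalIntegrable_point hf).smul _

lemma norm_segIntegral_le {f : ℂ → E} {s : ℂ × ℂ} {C : ℝ}
    (h : ∀ w ∈ segment ℝ s.1 s.2, ‖f w‖ ≤ C) : ‖segIntegral f s‖ ≤ ‖s.2 - s.1‖ * C := by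
  unfold segIntegral
  rw [norm_smul]
  gcongr
  simpa using intervalIntegral.norm_integral_le_of_norm_le_const (a := 0) (b := 1) (C := C)
    (f := fun t : ℝ => f (s.1 + (t : ℂ) * (s.2 - s.1)))
    fun t ht => h _ (point_mem_segment s (by
      rw [uIoc_of_le zero_le_one] at ht; exact ⟨ht.1.le, ht.2⟩))

lemma segIntegral_comm {f : ℂ → ℂ → E} {s r : ℂ × ℂ}
    (hf : ContinuousOn (Function.uncurry f) (segment ℝ s.1 s.2 ×ˢ segment ℝ r.1 r.2)) :
    segIntegral (fun z => segIntegral (fun w => f z w) r) s =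
      segIntegral (fun w => segIntegral (fun z => f z w) s) r := by
  unfold segIntegral
  simp only [intervalIntegral.integral_smul]
  rw [smul_comm, MeasureTheory.intervalIntegral_intervalIntegral_swap]
  rw [uIoc_of_le zero_le_one]
  refine MeasureTheory.IntegrableOn.mono_set (t := Icc (0 : ℝ) 1 ×ˢ Icc (0 : ℝ) 1) ?_
    (prod_mono Ioc_subset_Icc_self Ioc_subset_Icc_self)
  refine ContinuousOn.integrableOn_compact (isCompact_Icc.prod isCompact_Icc) ?_
  exact hf.comp (f := fun p : ℝ × ℝ =>
      (s.1 + (p.1 : ℂ) * (s.2 - s.1), r.1 + (p.2 : ℂ) * (r.2 - r.1))) (by fun_prop)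
    fun p hp => ⟨point_mem_segment s hp.1, point_mem_segment r hp.2⟩

@[simp] lemma chainIntegral_nil (f : ℂ → E) : chainIntegral f [] = 0 := rfl

lemma chainIntegral_cons (f : ℂ → E) (s : ℂ × ℂ) (Γ : Chain) :
    chainIntegral f (s :: Γ) = segIntegral f s + chainIntegral f Γ := by
  simp [chainIntegral]

lemma chainIntegral_append (f : ℂ → E) (Γ Δ : Chain) :
    chainIntegral f (Γ ++ Δ) = chainIntegral f Γ + chainIntegral f Δ := by
  simp [chainIntegral]

lemma trace_cons (s : ℂ × ℂ) (Γ : Chain) :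
    trace (s :: Γ) = segment ℝ s.1 s.2 ∪ trace Γ := by
  ext w; simp [trace]

lemma chainIntegral_congr {f g : ℂ → E} {Γ : Chain} (h : EqOn f g (trace Γ)) :
    chainIntegral f Γ = chainIntegral g Γ := by
  unfold chainIntegral
  congr 1
  exact List.map_congr_left fun s hs => segIntegral_congr (h.mono (segment_subset_trace hs))

lemma chainIntegral_add {f g : ℂ → E} {Γ : Chain} (hf : ContinuousOn f (trace Γ))
    (hg : ContinuousOn g (trace Γ)) :
    chainIntegral (fun z => f z + g z) Γ = chainIntegral f Γ + chainIntegral g Γ := by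
  induction Γ with
  | nil => simp
  | cons s Γ ih =>
    rw [trace_cons] at hf hg
    simp only [chainIntegral_cons]
    rw [ih (hf.mono subset_union_right) (hg.mono subset_union_right),
      segIntegral_add (hf.mono subset_union_left) (hg.mono subset_union_left)]
    abel

lemma chainIntegral_smul (c : ℂ) (f : ℂ → E) (Γ : Chain) :
    chainIntegral (fun z => c • f z) Γ = c • chainIntegral f Γ := by
  induction Γ with
  | nil => simp
  | cons s Γ ih => simp only [chainIntegral_cons, ih, segIntegral_smul, smul_add]

lemma chainIntegral_sub {f g : ℂ → E} {Γ : Chain} (hf : ContinuousOn f (trace Γ))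
    (hg : ContinuousOn g (trace Γ)) :
    chainIntegral (fun z => f z - g z) Γ = chainIntegral f Γ - chainIntegral g Γ := by
  have h := chainIntegral_add hf (g := fun z => (-1 : ℂ) • g z) (hg.const_smul _)
  rw [chainIntegral_smul] at h
  simpa [sub_eq_add_neg] using h

lemma chainIntegral_clm [CompleteSpace E] [CompleteSpace F] (L : E →L[ℂ] F) {f : ℂ → E}
    {Γ : Chain} (hf : ContinuousOn f (trace Γ)) :
    chainIntegral (fun z => L (f z)) Γ = L (chainIntegral f Γ) := by
  induction Γ with
  | nil => simp
  | cons s Γ ih =>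
    rw [trace_cons] at hf
    simp only [chainIntegral_cons]
    rw [ih (hf.mono subset_union_right), segIntegral_clm L (hf.mono subset_union_left), map_add]

lemma chainIntegral_smul_const [CompleteSpace E] {f : ℂ → ℂ} {Γ : Chain}
    (hf : ContinuousOn f (trace Γ)) (x : E) :
    chainIntegral (fun z => f z • x) Γ = chainIntegral f Γ • x :=
  chainIntegral_clm ((ContinuousLinearMap.id ℂ ℂ).smulRight x) hf

lemma continuousOn_segIntegral {f : ℂ → ℂ → E} {T : Set ℂ} {r : ℂ × ℂ} (hT : IsCompact T)
    (hf : ContinuousOn (Function.uncurry f) (T ×ˢ segment ℝ r.1 r.2)) :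
    ContinuousOn (fun z => segIntegral (fun w => f z w) r) T := by
  unfold segIntegral
  refine ContinuousOn.const_smul ?_ _
  rw [continuousOn_iff_continuous_domRestrict]
  have := isCompact_iff_compactSpace.mp hT
  have hc : Continuous fun p : T × Icc (0 : ℝ) 1 =>
      f p.1 (r.1 + ((p.2 : ℝ) : ℂ) * (r.2 - r.1)) :=
    hf.comp_continuous (f := fun p : T × Icc (0 : ℝ) 1 =>
      ((p.1 : ℂ), r.1 + ((p.2 : ℝ) : ℂ) * (r.2 - r.1))) (by fun_prop)
      fun p => ⟨p.1.2, point_mem_segment r p.2.2⟩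
  -- Clamping the parameter to [0, 1] makes the integrand continuous on all of T × ℝ without
  -- changing the integral.
  have hp : Continuous fun p : T × ℝ =>
      f p.1 (r.1 + ((projIcc (0 : ℝ) 1 zero_le_one p.2 : ℝ) : ℂ) * (r.2 - r.1)) :=
    hc.comp (f := fun p : T × ℝ => (p.1, projIcc (0 : ℝ) 1 zero_le_one p.2))
      (continuous_fst.prodMk (continuous_projIcc.comp continuous_snd))
  refine (intervalIntegral.continuous_parametric_intervalIntegral_of_continuous'
    (f := fun (z : T) (t : ℝ) => f z (r.1 + ((projIcc (0 : ℝ) 1 zero_le_one t : ℝ) : ℂ) *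
      (r.2 - r.1))) hp 0 1).congr
    fun z => intervalIntegral.integral_congr fun t ht => ?_
  rw [uIcc_of_le zero_le_one] at ht
  simp only [projIcc_of_mem zero_le_one ht]

lemma continuousOn_chainIntegral {f : ℂ → ℂ → E} {T : Set ℂ} {Δ : Chain} (hT : IsCompact T)
    (hf : ContinuousOn (Function.uncurry f) (T ×ˢ trace Δ)) :
    ContinuousOn (fun z => chainIntegral (fun w => f z w) Δ) T := by
  induction Δ with
  | nil => simp [continuousOn_const]
  | cons r Δ ih =>
    rw [trace_cons] at hf
    simp only [chainIntegral_cons]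
    exact (continuousOn_segIntegral hT (hf.mono (prod_mono_right subset_union_left))).add
      (ih (hf.mono (prod_mono_right subset_union_right)))

lemma segIntegral_chainIntegral_comm {f : ℂ → ℂ → E} {s : ℂ × ℂ} {Δ : Chain}
    (hf : ContinuousOn (Function.uncurry f) (segment ℝ s.1 s.2 ×ˢ trace Δ)) :
    segIntegral (fun z => chainIntegral (fun w => f z w) Δ) s =
      chainIntegral (fun w => segIntegral (fun z => f z w) s) Δ := by
  have hs : IsCompact (segment ℝ s.1 s.2) := by
    simpa [trace] using isCompact_trace [s]
  induction Δ with
  | nil => simp [segIntegral]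
  | cons r Δ ih =>
    rw [trace_cons] at hf
    have h1 := hf.mono (prod_mono_right (s := segment ℝ s.1 s.2)
      (subset_union_right (s := segment ℝ r.1 r.2) (t := trace Δ)))
    have h2 := hf.mono (prod_mono_right (s := segment ℝ s.1 s.2)
      (subset_union_left (s := segment ℝ r.1 r.2) (t := trace Δ)))
    simp only [chainIntegral_cons]
    rw [← ih h1, ← segIntegral_comm h2, segIntegral_add (continuousOn_segIntegral hs h2)
      (continuousOn_chainIntegral hs h1)]

/-- Fubini's theorem for chains. -/
lemma chainIntegral_comm {f : ℂ → ℂ → E} {Γ Δ : Chain}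
    (hf : ContinuousOn (Function.uncurry f) (trace Γ ×ˢ trace Δ)) :
    chainIntegral (fun z => chainIntegral (fun w => f z w) Δ) Γ =
      chainIntegral (fun w => chainIntegral (fun z => f z w) Γ) Δ := by
  induction Γ with
  | nil =>
    have h := chainIntegral_smul 0 (fun _ => (0 : E)) Δ
    simp only [smul_zero, zero_smul] at h
    simp [h]
  | cons s Γ ih =>
    rw [trace_cons] at hf
    have h1 := hf.mono (prod_mono_left (t := trace Δ)
      (subset_union_right (s := segment ℝ s.1 s.2) (t := trace Γ)))
    have h2 := hf.mono (prod_mono_left (t := trace Δ)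
      (subset_union_left (s := segment ℝ s.1 s.2) (t := trace Γ)))
    have hswap : ∀ {T : Set ℂ}, ContinuousOn (Function.uncurry f) (T ×ˢ trace Δ) →
        ContinuousOn (Function.uncurry fun w z => f z w) (trace Δ ×ˢ T) := fun h =>
      h.comp (f := Prod.swap) continuous_swap.continuousOn fun p hp => ⟨hp.2, hp.1⟩
    simp only [chainIntegral_cons]
    rw [ih h1, segIntegral_chainIntegral_comm h2, ← chainIntegral_add
      (continuousOn_segIntegral (isCompact_trace Δ) (hswap h2))
      (continuousOn_chainIntegral (isCompact_trace Δ) (hswap h1))]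

/-- Each segment contributes the difference of the primitive at its end points, and in a cycle
initial and end points cancel. -/
lemma chainIntegral_eq_zero_of_hasDerivAt [CompleteSpace E] {f g : ℂ → E} {Γ : Chain}
    (hΓ : IsCycle Γ) (hf : ContinuousOn f (trace Γ))
    (hg : ∀ w ∈ trace Γ, HasDerivAt g (f w) w) : chainIntegral f Γ = 0 := by
  -- The induction runs over arbitrary chains in the trace, since the tail of a cycle need not be a
  -- cycle.
  have h : ∀ Δ : Chain, trace Δ ⊆ trace Γ → chainIntegral f Δ =
      ((Δ.map Prod.snd).map g).sum - ((Δ.map Prod.fst).map g).sum := by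
    intro Δ
    induction Δ with
    | nil => simp
    | cons s Δ ih =>
      intro h
      rw [trace_cons, union_subset_iff] at h
      rw [chainIntegral_cons, ih h.2, segIntegral_eq_sub (hf.mono h.1) fun w hw => hg w (h.1 hw)]
      simp only [List.map_cons, List.sum_cons]
      abel
  rw [h Γ subset_rfl, (hΓ.map g).sum_eq, sub_self]

/-- The chain with all orientations reversed. -/
def rev (Γ : Chain) : Chain := Γ.map Prod.swap

lemma trace_rev (Γ : Chain) : trace (rev Γ) = trace Γ := by
  induction Γ with
  | nil => rfl
  | cons s Γ ih =>
    rw [rev, List.map_cons, trace_cons, trace_cons, ← ih, Prod.fst_swap, Prod.snd_swap,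
      segment_symm, rev]

lemma chainIntegral_rev (f : ℂ → E) (Γ : Chain) :
    chainIntegral f (rev Γ) = -chainIntegral f Γ := by
  induction Γ with
  | nil => simp [rev]
  | cons s Γ ih =>
    rw [rev, List.map_cons, chainIntegral_cons, chainIntegral_cons, ← rev, ih, segIntegral_swap]
    abel

lemma IsCycle.rev {Γ : Chain} (h : IsCycle Γ) : IsCycle (rev Γ) := by
  unfold IsCycle HolFC.rev at *
  simpa [List.map_map, Function.comp_def] using h.symm

lemma IsCycle.append {Γ Δ : Chain} (h : IsCycle Γ) (h' : IsCycle Δ) : IsCycle (Γ ++ Δ) := by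
  unfold IsCycle at *
  simpa using List.Perm.append h h'

end Chains

/-! ### Winding numbers -/

section Index

lemma continuousOn_inv_sub {Γ : Chain} {z : ℂ} (hz : z ∉ trace Γ) :
    ContinuousOn (fun w => (w - z)⁻¹) (trace Γ) := by
  refine ContinuousOn.inv₀ (by fun_prop) fun w hw h => hz ?_
  rwa [← sub_eq_zero.mp h]

lemma chainIntegral_inv_sub (Γ : Chain) (z : ℂ) :
    chainIntegral (fun w => (w - z)⁻¹) Γ = 2 * (Real.pi : ℂ) * Complex.I * index Γ z := by
  rw [index, mul_inv_cancel_left₀ Complex.two_pi_I_ne_zero]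

lemma index_append (Γ Δ : Chain) (z : ℂ) : index (Γ ++ Δ) z = index Γ z + index Δ z := by
  simp only [index, chainIntegral_append, mul_add]

lemma index_rev (Γ : Chain) (z : ℂ) : index (rev Γ) z = -index Γ z := by
  simp only [index, chainIntegral_rev, mul_neg]

/-- If the quotient were a real number -t ≤ 0, then w = (z + t z') / (1 + t) would lie on the
segment. -/
lemma mem_slitPlane_of_notMem_segment {z z' w : ℂ} (h : w ∉ segment ℝ z z') :
    (w - z) / (w - z') ∈ Complex.slitPlane := by
  by_contra hn
  rw [Complex.mem_slitPlane_iff] at hn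
  push Not at hn
  apply h
  have hz' : w - z' ≠ 0 := fun h0 => h (sub_eq_zero.mp h0 ▸ right_mem_segment ℝ z z')
  set t : ℝ := -((w - z) / (w - z')).re with ht
  have ht0 : 0 ≤ t := by linarith [hn.1]
  have he : (w - z) / (w - z') = -(t : ℂ) := by
    apply Complex.ext <;> simp [ht, hn.2]
  rw [div_eq_iff hz'] at he
  refine ⟨1 / (1 + t), t / (1 + t), by positivity, by positivity, by field_simp, ?_⟩
  have h1 : (1 + (t : ℂ)) ≠ 0 := by exact_mod_cast (by positivity : (1 + t) ≠ 0)
  simp only [Complex.real_smul]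
  push_cast
  field_simp
  linear_combination -he

/-- The index of a cycle is constant on segments that do not meet it. -/
lemma index_eq_of_segment {Γ : Chain} (hΓ : IsCycle Γ) {z z' : ℂ}
    (h : Disjoint (segment ℝ z z') (trace Γ)) : index Γ z = index Γ z' := by
  have hz : z ∉ trace Γ := fun h' => disjoint_left.mp h (left_mem_segment ℝ z z') h'
  have hz' : z' ∉ trace Γ := fun h' => disjoint_left.mp h (right_mem_segment ℝ z z') h'
  -- Off the segment the quotient (w - z) / (w - z') avoids the cut, so its principal logarithm is a
  -- primitive of the difference of the kernels.
  have h0 : chainIntegral (fun w => (w - z)⁻¹ - (w - z')⁻¹) Γ = 0 := by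
    refine chainIntegral_eq_zero_of_hasDerivAt hΓ
      ((continuousOn_inv_sub hz).sub (continuousOn_inv_sub hz'))
      (g := fun w => Complex.log ((w - z) / (w - z'))) fun w hw => ?_
    have h1 : w - z ≠ 0 := fun h => hz (by rwa [← sub_eq_zero.mp h])
    have h2 : w - z' ≠ 0 := fun h => hz' (by rwa [← sub_eq_zero.mp h])
    refine ((((hasDerivAt_id' w).sub_const z).div ((hasDerivAt_id' w).sub_const z') h2).clog
      (mem_slitPlane_of_notMem_segment fun h' => disjoint_left.mp h h' hw)).congr_deriv ?_
    simp only [Pi.div_apply]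
    field_simp
  rw [chainIntegral_sub (continuousOn_inv_sub hz) (continuousOn_inv_sub hz'), sub_eq_zero] at h0
  rw [index, index, h0]

/-- The factor `u` rotates the cut of the logarithm away from the cycle; log (u (w - z)) is then a
primitive of the kernel. -/
lemma index_eq_zero_of_exact {Γ : Chain} (hΓ : IsCycle Γ) {z u : ℂ} (hu : u ≠ 0)
    (h : ∀ w ∈ trace Γ, u * (w - z) ∈ Complex.slitPlane) : index Γ z = 0 := by
  have hz : z ∉ trace Γ := fun h' => by simpa using h z h'
  have h0 := chainIntegral_eq_zero_of_hasDerivAt hΓ (continuousOn_inv_sub hz)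
    (g := fun w => Complex.log (u * (w - z))) fun w hw => by
      refine ((((hasDerivAt_id' w).sub_const z).const_mul u).clog (h w hw)).congr_deriv ?_
      rw [mul_one, div_eq_mul_inv, mul_inv, mul_inv_cancel_left₀ hu]
  rw [index, h0, mul_zero]

/-- The points on a cycle and the points with nonzero index. -/
def hull (Γ : Chain) : Set ℂ := trace Γ ∪ {z | index Γ z ≠ 0}

lemma trace_subset_hull (Γ : Chain) : trace Γ ⊆ hull Γ := subset_union_left

/-- The index is locally constant off the trace, which gives closedness. Seen from a point farther
from 0 than the whole trace, the cycle lies in a half-plane, so the index is zero there. -/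
lemma isCompact_hull {Γ : Chain} (hΓ : IsCycle Γ) : IsCompact (hull Γ) := by
  refine Metric.isCompact_of_isClosed_isBounded ?_ ?_
  · rw [← isOpen_compl_iff, Metric.isOpen_iff]
    intro z hz
    simp only [hull, compl_union, mem_inter_iff, mem_compl_iff, mem_ofPred_eq, not_not] at hz
    obtain ⟨ε, hε, hb⟩ := Metric.isOpen_iff.mp (isClosed_trace Γ).isOpen_compl z hz.1
    refine ⟨ε, hε, fun z' hz' => ?_⟩
    simp only [hull, compl_union, mem_inter_iff, mem_compl_iff, mem_ofPred_eq, not_not]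
    refine ⟨hb hz', ?_⟩
    rw [← hz.2]
    refine (index_eq_of_segment hΓ (disjoint_left.mpr fun w hw => ?_)).symm
    exact hb ((convex_ball z ε).segment_subset (Metric.mem_ball_self hε) hz' hw)
  · obtain ⟨R, hR⟩ := (isCompact_trace Γ).isBounded.exists_norm_le
    refine (Metric.isBounded_closedBall (x := (0 : ℂ)) (r := max R 0)).subset ?_
    intro z hz
    rw [mem_closedBall_zero_iff]
    by_contra! hlt
    have hR0 : 0 ≤ max R 0 := le_max_right _ _
    have hz0 : 0 < ‖z‖ := by linarith
    rcases hz with hz | hz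
    · exact (hlt.trans_le ((hR z hz).trans (le_max_left _ _))).false
    -- Multiplication by -z̄ turns the direction from z to the origin into the positive real axis.
    · refine hz (index_eq_zero_of_exact hΓ (u := -(starRingEnd ℂ z)) ?_ fun w hw => ?_)
      · simpa using norm_pos_iff.mp hz0
      · left
        have h1 : ‖starRingEnd ℂ z * w‖ < ‖z‖ * ‖z‖ := by
          rw [norm_mul, Complex.norm_conj]
          exact mul_lt_mul_of_pos_left (((hR w hw).trans (le_max_left _ _)).trans_lt hlt) hz0
        have h2 := (Complex.re_le_norm (starRingEnd ℂ z * w)).trans_lt h1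
        have h3 : (starRingEnd ℂ z * z).re = ‖z‖ * ‖z‖ := by
          rw [mul_comm, Complex.mul_conj, Complex.ofReal_re, Complex.normSq_eq_norm_sq, sq]
        have h4 : -(starRingEnd ℂ z) * (w - z) = starRingEnd ℂ z * z - starRingEnd ℂ z * w := by
          ring
        rw [h4, Complex.sub_re, h3]
        linarith

end Index

/-! ### Grid squares and contours around compact sets -/

section Grid

/-- The boundary of the square with centre `c` and vertices `c ± v`, `c ± iv`. -/
noncomputable def square (c v : ℂ) : Chain :=
  [(c + v, c + Complex.I * v), (c + Complex.I * v, c - v), (c - v, c - Complex.I * v),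
    (c - Complex.I * v, c + v)]

lemma isCycle_square (c v : ℂ) : IsCycle (square c v) := by
  simp only [IsCycle, square, List.map_cons, List.map_nil]
  exact (List.perm_append_comm (l₁ := [c + v]) (l₂ := [_, _, _]))

/-- Seen from the centre, one side is a quarter turn: with primitive log ((w - c) / v) the integral
is log i - log 1. -/
lemma segIntegral_inv_quarter (c : ℂ) {v : ℂ} (hv : v ≠ 0) :
    segIntegral (fun w => (w - c)⁻¹) (c + v, c + Complex.I * v) = Real.pi / 2 * Complex.I := by
  have key : ∀ w ∈ segment ℝ (c + v) (c + Complex.I * v), (w - c) / v ∈ Complex.slitPlane := by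
    rintro w ⟨a, b, ha, hb, hab, rfl⟩
    have : (a • (c + v) + b • (c + Complex.I * v) - c) / v = a + b * Complex.I := by
      simp only [Complex.real_smul]
      have : (a : ℂ) + b = 1 := by exact_mod_cast hab
      field_simp
      linear_combination c * this
    rw [this, Complex.mem_slitPlane_iff]
    simp only [Complex.add_re, Complex.ofReal_re, Complex.re_ofReal_mul, Complex.I_re, mul_zero,
      add_zero, Complex.add_im, Complex.ofReal_im, Complex.im_ofReal_mul, Complex.I_im, mul_one,
      zero_add]
    by_cases h : b = 0
    · left; linarith
    · exact Or.inr h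
  have hne : ∀ w ∈ segment ℝ (c + v) (c + Complex.I * v), w - c ≠ 0 := fun w hw h => by
    simpa [h] using key w hw
  rw [segIntegral_eq_sub (f := fun w => (w - c)⁻¹) (g := fun w => Complex.log ((w - c) / v))
    (ContinuousOn.inv₀ (by fun_prop) hne)]
  · simp only [add_sub_cancel_left, mul_div_cancel_right₀ _ hv, div_self hv, Complex.log_I,
      Complex.log_one, sub_zero]
  · intro w hw
    have := hne w hw
    refine ((((hasDerivAt_id' w).sub_const c).div_const v).clog (key w hw)).congr_deriv ?_
    field_simp

lemma index_square_center (c : ℂ) {v : ℂ} (hv : v ≠ 0) : index (square c v) c = 1 := by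
  have h1 := segIntegral_inv_quarter c hv
  have h2 := segIntegral_inv_quarter c (mul_ne_zero Complex.I_ne_zero hv)
  have h3 := segIntegral_inv_quarter c (neg_ne_zero.mpr hv)
  have h4 := segIntegral_inv_quarter c (mul_ne_zero Complex.I_ne_zero (neg_ne_zero.mpr hv))
  have e1 : c + Complex.I * (Complex.I * v) = c - v := by
    rw [← mul_assoc, Complex.I_mul_I]; ring
  have e2 : c + Complex.I * (Complex.I * -v) = c + v := by
    rw [← mul_assoc, Complex.I_mul_I]; ring
  have e3 : c + Complex.I * -v = c - Complex.I * v := by ring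
  rw [e1] at h2
  rw [e2, e3] at h4
  rw [e3, ← sub_eq_add_neg] at h3
  rw [index, square]
  simp only [chainIntegral_cons, chainIntegral_nil, h1, h2, h3, h4]
  have := Complex.two_pi_I_ne_zero
  field_simp
  ring

/-- The point of the `δ`-grid with integer coordinates `p`. -/
def gridPt (δ : ℝ) (p : ℤ × ℤ) : ℂ := ⟨δ * p.1, δ * p.2⟩

/-- The closed square of the `δ`-grid with lower left vertex `q`. -/
def cell (δ : ℝ) (q : ℤ × ℤ) : Set ℂ :=
  {w | w.re ∈ Icc (δ * q.1) (δ * (q.1 + 1)) ∧ w.im ∈ Icc (δ * q.2) (δ * (q.2 + 1))}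

/-- The open square of the `δ`-grid with lower left vertex `q`. -/
def openCell (δ : ℝ) (q : ℤ × ℤ) : Set ℂ :=
  {w | w.re ∈ Ioo (δ * q.1) (δ * (q.1 + 1)) ∧ w.im ∈ Ioo (δ * q.2) (δ * (q.2 + 1))}

/-- The oriented edges of a grid square. -/
def cellEdges (q : ℤ × ℤ) : Finset ((ℤ × ℤ) × (ℤ × ℤ)) :=
  {((q.1, q.2), (q.1 + 1, q.2)), ((q.1 + 1, q.2), (q.1 + 1, q.2 + 1)),
    ((q.1 + 1, q.2 + 1), (q.1, q.2 + 1)), ((q.1, q.2 + 1), (q.1, q.2))}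

/-- The segment of the complex plane given by an edge of the grid. -/
def edgeSeg (δ : ℝ) (e : (ℤ × ℤ) × (ℤ × ℤ)) : ℂ × ℂ := (gridPt δ e.1, gridPt δ e.2)

/-- The centre of a grid square. -/
noncomputable def cellCenter (δ : ℝ) (q : ℤ × ℤ) : ℂ := ⟨δ * (q.1 + 1 / 2), δ * (q.2 + 1 / 2)⟩

/-- The positively oriented boundary of a grid square. -/
noncomputable def cellChain (δ : ℝ) (q : ℤ × ℤ) : Chain :=
  square (cellCenter δ q) ⟨-(δ / 2), -(δ / 2)⟩

lemma sum_cellEdges {M : Type*} [AddCommGroup M] (φ : (ℤ × ℤ) × (ℤ × ℤ) → M) (q : ℤ × ℤ) :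
    ∑ e ∈ cellEdges q, φ e = φ ((q.1, q.2), (q.1 + 1, q.2)) +
      (φ ((q.1 + 1, q.2), (q.1 + 1, q.2 + 1)) + (φ ((q.1 + 1, q.2 + 1), (q.1, q.2 + 1)) +
      φ ((q.1, q.2 + 1), (q.1, q.2)))) := by
  rw [cellEdges, Finset.sum_insert, Finset.sum_insert, Finset.sum_insert, Finset.sum_singleton]
  all_goals simp [Prod.ext_iff]

lemma mem_cellEdges {q : ℤ × ℤ} {e : (ℤ × ℤ) × (ℤ × ℤ)} : e ∈ cellEdges q ↔
    e = ((q.1, q.2), (q.1 + 1, q.2)) ∨ e = ((q.1 + 1, q.2), (q.1 + 1, q.2 + 1)) ∨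
    e = ((q.1 + 1, q.2 + 1), (q.1, q.2 + 1)) ∨ e = ((q.1, q.2 + 1), (q.1, q.2)) := by
  simp [cellEdges]

/-- Links the two descriptions of the boundary: the rotation-symmetric one gives the index, the one
by integer edges gives cancellation between neighbours. -/
lemma cellChain_eq (δ : ℝ) (q : ℤ × ℤ) : cellChain δ q =
    [edgeSeg δ ((q.1, q.2), (q.1 + 1, q.2)), edgeSeg δ ((q.1 + 1, q.2), (q.1 + 1, q.2 + 1)),
      edgeSeg δ ((q.1 + 1, q.2 + 1), (q.1, q.2 + 1)), edgeSeg δ ((q.1, q.2 + 1), (q.1, q.2))] := by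
  simp only [cellChain, square, edgeSeg, cellCenter, gridPt, List.cons.injEq, Prod.mk.injEq,
    Complex.ext_iff, Complex.add_re, Complex.add_im, Complex.sub_re, Complex.sub_im,
    Complex.mul_re, Complex.mul_im, Complex.I_re, Complex.I_im, and_true]
  push_cast
  refine ⟨⟨⟨?_, ?_⟩, ?_, ?_⟩, ⟨⟨?_, ?_⟩, ?_, ?_⟩, ⟨⟨?_, ?_⟩, ?_, ?_⟩, ⟨?_, ?_⟩, ?_, ?_⟩ <;> ring

lemma exists_of_mem_segment {p q w : ℂ} (h : w ∈ segment ℝ p q) : ∃ t ∈ Icc (0 : ℝ) 1,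
    w.re = p.re + t * (q.re - p.re) ∧ w.im = p.im + t * (q.im - p.im) := by
  rw [segment_eq_image'] at h
  obtain ⟨t, ht, rfl⟩ := h
  exact ⟨t, ht, by simp, by simp⟩

lemma edge_subset {δ : ℝ} (hδ : 0 < δ) {q : ℤ × ℤ} {e : (ℤ × ℤ) × (ℤ × ℤ)}
    (he : e ∈ cellEdges q) :
    segment ℝ (edgeSeg δ e).1 (edgeSeg δ e).2 ⊆ cell δ q \ openCell δ q := by
  intro w hw
  obtain ⟨t, ht, hre, him⟩ := exists_of_mem_segment hw
  have h0 : 0 ≤ t * δ := mul_nonneg ht.1 hδ.le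
  have h1 : t * δ ≤ δ := mul_le_of_le_one_left hδ.le ht.2
  rw [mem_cellEdges] at he
  simp only [cell, openCell, mem_sdiff, mem_ofPred_eq, mem_Icc, mem_Ioo]
  rcases he with rfl | rfl | rfl | rfl <;>
  · simp only [edgeSeg, gridPt] at hre him
    push_cast at hre him
    refine ⟨⟨⟨?_, ?_⟩, ?_, ?_⟩, ?_⟩
    on_goal 5 => rintro ⟨⟨h3, h4⟩, h5, h6⟩
    all_goals ring_nf at *; linarith

lemma trace_cellChain_subset {δ : ℝ} (hδ : 0 < δ) (q : ℤ × ℤ) :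
    trace (cellChain δ q) ⊆ cell δ q \ openCell δ q := by
  rintro w ⟨s, hs, hw⟩
  rw [cellChain_eq] at hs
  simp only [List.mem_cons, List.not_mem_nil, or_false] at hs
  rcases hs with rfl | rfl | rfl | rfl
  all_goals exact edge_subset hδ (mem_cellEdges.mpr (by simp)) hw

lemma convex_openCell (δ : ℝ) (q : ℤ × ℤ) : Convex ℝ (openCell δ q) :=
  ((convex_Ioo _ _).is_linear_preimage Complex.reLm.isLinear).inter
    ((convex_Ioo _ _).is_linear_preimage Complex.imLm.isLinear)

lemma cellCenter_mem {δ : ℝ} (hδ : 0 < δ) (q : ℤ × ℤ) : cellCenter δ q ∈ openCell δ q := by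
  simp only [cellCenter, openCell, mem_ofPred_eq, mem_Ioo]
  refine ⟨⟨?_, ?_⟩, ?_, ?_⟩ <;> nlinarith

lemma index_cellChain_of_mem {δ : ℝ} (hδ : 0 < δ) {q : ℤ × ℤ} {z : ℂ} (hz : z ∈ openCell δ q) :
    index (cellChain δ q) z = 1 := by
  rw [index_eq_of_segment (Γ := cellChain δ q) (isCycle_square _ _) (z' := cellCenter δ q), cellChain,
    index_square_center]
  · simp [Complex.ext_iff, hδ.ne']
  · refine disjoint_left.mpr fun w hw hw' => (trace_cellChain_subset hδ q hw').2 ?_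
    exact (convex_openCell δ q).segment_subset hz (cellCenter_mem hδ q) hw

/-- A coordinate line through `z` has the whole cell strictly on one side; the factors 1, -1, -i, i
turn that side into the right half-plane. -/
lemma index_cellChain_of_notMem {δ : ℝ} (hδ : 0 < δ) {q : ℤ × ℤ} {z : ℂ} (hz : z ∉ cell δ q) :
    index (cellChain δ q) z = 0 := by
  have hc : IsCycle (cellChain δ q) := isCycle_square _ _
  have ht : ∀ w ∈ trace (cellChain δ q), w ∈ cell δ q := fun w hw =>
    (trace_cellChain_subset hδ q hw).1
  simp only [cell, mem_ofPred_eq, mem_Icc, not_and_or, not_le] at hz ht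
  rcases hz with (hz | hz) | (hz | hz)
  · refine index_eq_zero_of_exact hc one_ne_zero fun w hw => Or.inl ?_
    simp only [one_mul, Complex.sub_re]
    linarith [(ht w hw).1.1]
  · refine index_eq_zero_of_exact hc (neg_ne_zero.mpr one_ne_zero) fun w hw => Or.inl ?_
    simp only [neg_mul, one_mul, Complex.neg_re, Complex.sub_re]
    linarith [(ht w hw).1.2]
  · refine index_eq_zero_of_exact hc (neg_ne_zero.mpr Complex.I_ne_zero) fun w hw => Or.inl ?_
    simp only [neg_mul, Complex.neg_re, Complex.I_mul_re, Complex.sub_im]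
    linarith [(ht w hw).2.1]
  · refine index_eq_zero_of_exact hc Complex.I_ne_zero fun w hw => Or.inl ?_
    simp only [Complex.I_mul_re, Complex.sub_im]
    linarith [(ht w hw).2.2]

/-- The oriented edges of the squares in `S`. -/
def gridEdges (S : Finset (ℤ × ℤ)) : Finset ((ℤ × ℤ) × (ℤ × ℤ)) := S.biUnion cellEdges

/-- The oriented edges of the squares in `S` that are not cancelled by an opposite edge. -/
def gridBoundary (S : Finset (ℤ × ℤ)) : Finset ((ℤ × ℤ) × (ℤ × ℤ)) :=
  (gridEdges S).filter fun e => e.swap ∉ gridEdges S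

/-- An edge and its reverse, if both present, contribute opposite terms, so `Prod.swap` pairs off
everything outside the boundary. The double sum can be read over a union because an oriented edge
belongs to only one square. -/
lemma sum_gridBoundary {M : Type*} [AddCommGroup M] (S : Finset (ℤ × ℤ))
    (φ : (ℤ × ℤ) × (ℤ × ℤ) → M) (hφ : ∀ e, φ e.swap = -φ e) :
    ∑ e ∈ gridBoundary S, φ e = ∑ q ∈ S, ∑ e ∈ cellEdges q, φ e := by
  rw [← Finset.sum_biUnion]
  · change _ = ∑ e ∈ gridEdges S, φ e
    rw [← Finset.sum_filter_add_sum_filter_not (gridEdges S) (fun e => e.swap ∉ gridEdges S) φ]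
    rw [gridBoundary, left_eq_add]
    refine Finset.sum_involution (fun e _ => e.swap) (fun e _ => by rw [hφ, add_neg_cancel])
      (fun e he _ h => ?_) (fun e he => ?_) fun e _ => Prod.swap_swap e
    · obtain ⟨he, -⟩ := Finset.mem_filter.mp he
      obtain ⟨q, -, hq⟩ := Finset.mem_biUnion.mp he
      rw [mem_cellEdges] at hq
      rcases hq with rfl | rfl | rfl | rfl <;> simp [Prod.ext_iff] at h
    · simp only [Finset.mem_filter, not_not, Prod.swap_swap] at he ⊢
      exact he.symm
  · intro q _ q' _ hne
    refine Finset.disjoint_left.mpr fun e he he' => hne ?_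
    rw [mem_cellEdges] at he he'
    rcases he with rfl | rfl | rfl | rfl <;>
    · simp only [Prod.ext_iff] at he' ⊢
      omega

/-- The boundary of the union of the grid squares in `S`. -/
noncomputable def gridChain (δ : ℝ) (S : Finset (ℤ × ℤ)) : Chain :=
  (gridBoundary S).toList.map (edgeSeg δ)

lemma chainIntegral_gridChain {E : Type*} [NormedAddCommGroup E] [NormedSpace ℂ E] (f : ℂ → E)
    (δ : ℝ) (S : Finset (ℤ × ℤ)) :
    chainIntegral f (gridChain δ S) = ∑ q ∈ S, chainIntegral f (cellChain δ q) := by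
  rw [chainIntegral, gridChain, List.map_map, Finset.sum_map_toList, sum_gridBoundary]
  · refine Finset.sum_congr rfl fun q _ => ?_
    rw [sum_cellEdges, cellChain_eq]
    simp [chainIntegral_cons]
  · exact fun e => segIntegral_swap f (edgeSeg δ e)

lemma natCast_count_map {α β : Type*} [BEq β] [LawfulBEq β] [DecidableEq β] (f : α → β) (v : β) (l : List α) :
    (((l.map f).count v : ℕ) : ℤ) = (l.map fun e => if f e = v then 1 else 0).sum := by
  induction l with
  | nil => simp
  | cons a l ih => simp [List.count_cons, ih, add_comm]

/-- Cancellation applies to φ e = [e.1 = v] - [e.2 = v], whose sum around any square is zero.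
Counting is done with integer vertices, where equality is decidable, and then transported to ℂ. -/
lemma isCycle_gridChain (δ : ℝ) (S : Finset (ℤ × ℤ)) : IsCycle (gridChain δ S) := by
  have h : ((gridBoundary S).toList.map Prod.fst).Perm ((gridBoundary S).toList.map Prod.snd) := by
    rw [List.perm_iff_count]
    intro v
    rw [← Int.natCast_inj, natCast_count_map, natCast_count_map, Finset.sum_map_toList,
      Finset.sum_map_toList, ← sub_eq_zero, ← Finset.sum_sub_distrib, sum_gridBoundary]
    · refine Finset.sum_eq_zero fun q _ => ?_
      rw [sum_cellEdges]
      abel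
    · intro e
      simp
  simpa [IsCycle, gridChain, edgeSeg, List.map_map, Function.comp_def] using h.map (gridPt δ)

lemma exists_swap_mem_cellEdges {q : ℤ × ℤ} {e : (ℤ × ℤ) × (ℤ × ℤ)} (he : e ∈ cellEdges q) :
    ∃ q', e.swap ∈ cellEdges q' := by
  rw [mem_cellEdges] at he
  simp only [mem_cellEdges]
  rcases he with rfl | rfl | rfl | rfl
  · exact ⟨(q.1, q.2 - 1), by simp⟩
  · exact ⟨(q.1 + 1, q.2), by simp⟩
  · exact ⟨(q.1, q.2 + 1), by simp⟩
  · exact ⟨(q.1 - 1, q.2), by simp⟩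

/-- If a boundary edge met `K`, the square across it would also meet `K`, hence belong to `S` and
supply the reversed edge, so the edge would have been cancelled. -/
lemma trace_gridChain_subset {δ : ℝ} (hδ : 0 < δ) {S : Finset (ℤ × ℤ)} {K : Set ℂ}
    (hS : ∀ q, q ∈ S ↔ (cell δ q ∩ K).Nonempty) :
    trace (gridChain δ S) ⊆ (⋃ q ∈ S, cell δ q) \ K := by
  rintro w ⟨s, hs, hw⟩
  obtain ⟨e, he, rfl⟩ := List.mem_map.mp hs
  rw [Finset.mem_toList, gridBoundary, Finset.mem_filter] at he
  obtain ⟨q, hqS, hq⟩ := Finset.mem_biUnion.mp he.1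
  refine ⟨mem_biUnion hqS (edge_subset hδ hq hw).1, fun hK => he.2 ?_⟩
  obtain ⟨q', hq'⟩ := exists_swap_mem_cellEdges hq
  refine Finset.mem_biUnion.mpr ⟨q', (hS q').mpr ⟨w, ?_, hK⟩, hq'⟩
  refine (edge_subset hδ hq' ?_).1
  rw [segment_symm]
  exact hw

lemma exists_mem_cell {δ : ℝ} (hδ : 0 < δ) (z : ℂ) : ∃ q, z ∈ cell δ q := by
  refine ⟨(⌊z.re / δ⌋, ⌊z.im / δ⌋), ?_⟩
  have h1 := Int.floor_le (z.re / δ)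
  have h2 := (Int.lt_floor_add_one (z.re / δ)).le
  have h3 := Int.floor_le (z.im / δ)
  have h4 := (Int.lt_floor_add_one (z.im / δ)).le
  rw [le_div_iff₀' hδ] at h1 h3
  rw [div_le_iff₀' hδ] at h2 h4
  exact ⟨⟨h1, h2⟩, h3, h4⟩

lemma eq_of_mem_openCell_of_mem_cell {δ : ℝ} (hδ : 0 < δ) {q q' : ℤ × ℤ} {z : ℂ}
    (h : z ∈ openCell δ q) (h' : z ∈ cell δ q') : q = q' := by
  obtain ⟨⟨h1, h2⟩, h3, h4⟩ := h
  obtain ⟨⟨k1, k2⟩, k3, k4⟩ := h'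
  have a1 := lt_of_mul_lt_mul_left (h1.trans_le k2) hδ.le
  have a2 := lt_of_mul_lt_mul_left (k1.trans_lt h2) hδ.le
  have a3 := lt_of_mul_lt_mul_left (h3.trans_le k4) hδ.le
  have a4 := lt_of_mul_lt_mul_left (k3.trans_lt h4) hδ.le
  norm_cast at a1 a2 a3 a4
  ext <;> omega

lemma cell_subset_ball {δ : ℝ} (hδ : 0 < δ) {q : ℤ × ℤ} {k : ℂ} (hk : k ∈ cell δ q) :
    cell δ q ⊆ Metric.ball k (3 * δ) := by
  intro w hw
  obtain ⟨⟨h1, h2⟩, h3, h4⟩ := hw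
  obtain ⟨⟨k1, k2⟩, k3, k4⟩ := hk
  rw [mem_ball_iff_norm]
  refine (Complex.norm_le_abs_re_add_abs_im _).trans_lt ?_
  have a : |(w - k).re| ≤ δ := by rw [Complex.sub_re, abs_le]; constructor <;> linarith
  have b : |(w - k).im| ≤ δ := by rw [Complex.sub_im, abs_le]; constructor <;> linarith
  linarith

lemma finite_cells {δ : ℝ} (hδ : 0 < δ) {K : Set ℂ} (hK : IsCompact K) :
    {q | (cell δ q ∩ K).Nonempty}.Finite := by
  obtain ⟨R, hR⟩ := hK.isBounded.exists_norm_le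
  obtain ⟨N, hN⟩ := exists_nat_gt (R / δ + 1)
  refine ((finite_Icc (-(N : ℤ)) N).prod (finite_Icc (-(N : ℤ)) N)).subset ?_
  rintro q ⟨w, ⟨⟨h1, h2⟩, h3, h4⟩, hw⟩
  have hre := abs_le.mp ((Complex.abs_re_le_norm w).trans (hR w hw))
  have him := abs_le.mp ((Complex.abs_im_le_norm w).trans (hR w hw))
  have hN' : R < δ * (N - 1) := by
    rw [← div_lt_iff₀' hδ]; linarith
  have a1 : (q.1 : ℝ) < N := lt_of_mul_lt_mul_left (a := δ) (by nlinarith) hδ.le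
  have a2 : (q.2 : ℝ) < N := lt_of_mul_lt_mul_left (a := δ) (by nlinarith) hδ.le
  have a3 : -(N : ℝ) < q.1 := lt_of_mul_lt_mul_left (a := δ) (by nlinarith) hδ.le
  have a4 : -(N : ℝ) < q.2 := lt_of_mul_lt_mul_left (a := δ) (by nlinarith) hδ.le
  norm_cast at a1 a2
  have a3' : -(N : ℤ) < q.1 := by exact_mod_cast a3
  have a4' : -(N : ℤ) < q.2 := by exact_mod_cast a4
  exact ⟨⟨a3'.le, a1.le⟩, a4'.le, a2.le⟩

/-- A compact subset of an open set is surrounded by a cycle along which the integrals of all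
holomorphic functions vanish. -/
theorem exists_grid_cycle {K U : Set ℂ} (hK : IsCompact K) (hU : IsOpen U) (hKU : K ⊆ U) :
    ∃ Γ : Chain, IsCycle Γ ∧ trace Γ ⊆ U \ K ∧ (∀ z ∈ K, index Γ z = 1) ∧
      ∀ g : ℂ → ℂ, DifferentiableOn ℂ g U → chainIntegral g Γ = 0 := by
  obtain ⟨ε, hε, hεU⟩ := hK.exists_thickening_subset_open hU hKU
  -- A cell lies in the ball of radius 3δ about any of its points, so this makes each chosen cell
  -- fit into an ε-ball inside `U`.
  set δ := ε / 3 with hδdef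
  have hδ : 0 < δ := by positivity
  set S := (finite_cells hδ hK).toFinset with hSdef
  have hS : ∀ q, q ∈ S ↔ (cell δ q ∩ K).Nonempty := fun q => by simp [hSdef]
  have hball : ∀ q ∈ S, ∃ k, cell δ q ⊆ Metric.ball k ε ∧ Metric.ball k ε ⊆ U := by
    intro q hq
    obtain ⟨k, hk, hkK⟩ := (hS q).mp hq
    refine ⟨k, ?_, (Metric.ball_subset_thickening hkK ε).trans hεU⟩
    have h := cell_subset_ball hδ hk
    rwa [show 3 * δ = ε by rw [hδdef]; ring] at h
  have htr := trace_gridChain_subset hδ hS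
  refine ⟨gridChain δ S, isCycle_gridChain δ S, fun w hw => ?_, fun z hz => ?_, fun g hg => ?_⟩
  · obtain ⟨h1, h2⟩ := htr hw
    simp only [mem_iUnion] at h1
    obtain ⟨q, hq, hwq⟩ := h1
    obtain ⟨k, hk, hkU⟩ := hball q hq
    exact ⟨hkU (hk hwq), h2⟩
  · obtain ⟨q, hq⟩ := exists_mem_cell hδ z
    have hqS : q ∈ S := (hS q).mpr ⟨z, hq, hz⟩
    obtain ⟨r, hr, hrb⟩ := Metric.isOpen_iff.mp (isClosed_trace (gridChain δ S)).isOpen_compl z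
      fun h => (htr h).2 hz
    -- The point z may lie on an edge between cells, where the indices of the single squares are not
    -- controlled. It is off the total trace, so it can be moved slightly towards the centre of its
    -- cell without changing the index.
    obtain ⟨z', hz'q, hz'r⟩ : ∃ z' ∈ openCell δ q, z' ∈ Metric.ball z r := by
      have hc : Filter.Tendsto (fun s : ℝ => z + s • (cellCenter δ q - z))
          (nhdsWithin 0 (Ioi 0)) (nhds z) := by
        have : Continuous fun s : ℝ => z + s • (cellCenter δ q - z) := by fun_prop
        simpa using (this.tendsto 0).mono_left nhdsWithin_le_nhds
      obtain ⟨s, hs, hs1⟩ := ((hc.eventually (Metric.ball_mem_nhds z hr)).and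
        (Ioo_mem_nhdsGT (zero_lt_one' ℝ))).exists
      refine ⟨_, ?_, hs⟩
      obtain ⟨⟨h1, h2⟩, h3, h4⟩ := hq
      obtain ⟨⟨k1, k2⟩, k3, k4⟩ := cellCenter_mem hδ q
      simp only [openCell, mem_ofPred_eq, mem_Ioo, Complex.add_re, Complex.add_im,
        Complex.smul_re, Complex.smul_im, smul_eq_mul, Complex.sub_re, Complex.sub_im]
      obtain ⟨s0, s1⟩ := hs1
      refine ⟨⟨?_, ?_⟩, ?_, ?_⟩ <;> nlinarith
    rw [index_eq_of_segment (isCycle_gridChain δ S) (z' := z') (disjoint_left.mpr fun w hw => hrb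
      ((convex_ball z r).segment_subset (Metric.mem_ball_self hr) hz'r hw)), index,
      chainIntegral_gridChain, Finset.mul_sum]
    change ∑ q ∈ S, index (cellChain δ q) z' = 1
    rw [Finset.sum_eq_single_of_mem q hqS, index_cellChain_of_mem hδ hz'q]
    exact fun q' _ hne => index_cellChain_of_notMem hδ fun h =>
      hne (eq_of_mem_openCell_of_mem_cell hδ hz'q h).symm
  · rw [chainIntegral_gridChain]
    refine Finset.sum_eq_zero fun q hq => ?_
    obtain ⟨k, hk, hkU⟩ := hball q hq
    -- Each square lies in a ball inside `U`, where `g` has a primitive, so only the local Cauchy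
    -- theorem is needed.
    obtain ⟨G, hG⟩ := (hg.mono hkU).isExactOn_ball
    have hsub : trace (cellChain δ q) ⊆ Metric.ball k ε := fun w hw =>
      hk (trace_cellChain_subset hδ q hw).1
    exact chainIntegral_eq_zero_of_hasDerivAt (isCycle_square _ _)
      (hg.continuousOn.mono (hsub.trans hkU)) fun w hw => hG w (hsub hw)

end Grid

/-! ### Cauchy's theorem and integral formula for cycles -/

section Cauchy
variable {E : Type*} [NormedAddCommGroup E] [NormedSpace ℂ E] [CompleteSpace E]

/-- The difference quotient `dslope g z` is holomorphic on all of `U`, so its integral vanishes;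
splitting it off the diagonal leaves the index. -/
lemma chainIntegral_inv_sub_mul {Γ : Chain} {U : Set ℂ} (hU : IsOpen U) (hΓU : trace Γ ⊆ U)
    (hv : ∀ g : ℂ → ℂ, DifferentiableOn ℂ g U → chainIntegral g Γ = 0)
    {g : ℂ → ℂ} (hg : DifferentiableOn ℂ g U) {z : ℂ} (hz : z ∈ U) (hzΓ : z ∉ trace Γ) :
    chainIntegral (fun w => (w - z)⁻¹ * g w) Γ = 2 * (Real.pi : ℂ) * Complex.I * index Γ z * g z := by
  have h0 := hv _ ((Complex.differentiableOn_dslope (hU.mem_nhds hz)).mpr hg)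
  have hi := continuousOn_inv_sub hzΓ
  rw [chainIntegral_congr (g := fun w => (w - z)⁻¹ * g w - (w - z)⁻¹ • g z) fun w hw => ?_,
    chainIntegral_sub (hi.fun_mul (hg.continuousOn.mono hΓU)) (hi.fun_smul continuousOn_const),
    chainIntegral_smul_const hi, sub_eq_zero, chainIntegral_inv_sub] at h0
  · exact h0
  · have hne : w ≠ z := fun h => hzΓ (h ▸ hw)
    simp only [dslope_of_ne _ hne, slope_def_field, smul_eq_mul]
    rw [div_eq_inv_mul, mul_sub]

lemma index_eq_zero_of_integrals_vanish {Γ : Chain} {U : Set ℂ}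
    (hv : ∀ g : ℂ → ℂ, DifferentiableOn ℂ g U → chainIntegral g Γ = 0) {z : ℂ} (hz : z ∉ U) :
    index Γ z = 0 := by
  rw [index, hv, mul_zero]
  exact ((differentiableOn_id.sub_const z).inv fun w hw h => hz (sub_eq_zero.mp h ▸ hw))

lemma hull_subset {Γ : Chain} {U : Set ℂ} (h : trace Γ ⊆ U) (h0 : ∀ z ∉ U, index Γ z = 0) :
    hull Γ ⊆ U :=
  union_subset h fun z hz => by_contra fun h' => hz (h0 z h')

lemma index_eq_zero_of_notMem_hull {Γ : Chain} {z : ℂ} (hz : z ∉ hull Γ) : index Γ z = 0 :=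
  by_contra fun h => hz (Or.inr h)

lemma continuousOn_inv_sub_prod {S T : Set ℂ} (h : Disjoint S T) :
    ContinuousOn (fun p : ℂ × ℂ => (p.2 - p.1)⁻¹) (S ×ˢ T) :=
  ContinuousOn.inv₀ (by fun_prop) fun p hp h0 =>
    disjoint_left.mp h hp.1 (sub_eq_zero.mp h0 ▸ hp.2)

/-- The homology version of Cauchy's theorem. -/
theorem chainIntegral_eq_zero {Γ : Chain} (hΓ : IsCycle Γ) {U : Set ℂ} (hU : IsOpen U)
    (hΓU : trace Γ ⊆ U) (h0 : ∀ z ∉ U, index Γ z = 0) {g : ℂ → E}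
    (hg : DifferentiableOn ℂ g U) : chainIntegral g Γ = 0 := by
  have scalar : ∀ g : ℂ → ℂ, DifferentiableOn ℂ g U → chainIntegral g Γ = 0 := by
    intro g hg
    -- On Γ, `g` is given by its Cauchy integral over Δ. After exchanging the integrals, the inner
    -- one is the index of Γ about a point outside `hull Γ`, which is zero.
    obtain ⟨Δ, -, hΔU, hΔ1, hΔ0⟩ := exists_grid_cycle (isCompact_hull hΓ) hU (hull_subset hΓU h0)
    have hdisj : Disjoint (trace Γ) (trace Δ) :=
      disjoint_left.mpr fun w hw hw' => (hΔU hw').2 (trace_subset_hull Γ hw)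
    have hF : ∀ z ∈ trace Γ, chainIntegral (fun w => (w - z)⁻¹ * g w) Δ =
        (2 * (Real.pi : ℂ) * Complex.I) • g z := fun z hz => by
      rw [chainIntegral_inv_sub_mul hU (fun w hw => (hΔU hw).1) hΔ0 hg (hΓU hz)
        (disjoint_left.mp hdisj hz), hΔ1 z (trace_subset_hull Γ hz), mul_one, smul_eq_mul]
    have h1 : chainIntegral (fun z => chainIntegral (fun w => (w - z)⁻¹ * g w) Δ) Γ = 0 := by
      rw [chainIntegral_comm]
      · rw [chainIntegral_congr (g := fun _ => (0 : ℂ) • (0 : ℂ)), chainIntegral_smul, zero_smul]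
        intro w hw
        have hw0 : w ∉ hull Γ := (hΔU hw).2
        have hwΓ : w ∉ trace Γ := fun h => hw0 (Or.inl h)
        have e : ∀ z, (w - z)⁻¹ * g w = (z - w)⁻¹ • -g w := fun z => by
          rw [smul_eq_mul, ← neg_sub, inv_neg]; ring
        simp only [e]
        rw [chainIntegral_smul_const (continuousOn_inv_sub hwΓ), chainIntegral_inv_sub,
          index_eq_zero_of_notMem_hull hw0]
        simp
      · exact (continuousOn_inv_sub_prod hdisj).mul
          ((hg.continuousOn.mono fun w hw => (hΔU hw).1).comp continuousOn_snd fun p hp => hp.2)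
    rw [chainIntegral_congr hF, chainIntegral_smul] at h1
    exact (smul_eq_zero.mp h1).resolve_left Complex.two_pi_I_ne_zero
  -- Continuous functionals separate points, which reduces the vector-valued case to the scalar one.
  refine (SeparatingDual.eq_zero_iff_forall_dual_eq_zero (R := ℂ) _).mpr fun L => ?_
  rw [← chainIntegral_clm L (hg.continuousOn.mono hΓU)]
  exact scalar _ (L.differentiable.comp_differentiableOn hg)

theorem exists_surrounds {K U : Set ℂ} (hK : IsCompact K) (hU : IsOpen U) (hKU : K ⊆ U) :
    ∃ Γ : Chain, Surrounds Γ K U := by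
  obtain ⟨Γ, h1, h2, h3, h4⟩ := exists_grid_cycle hK hU hKU
  exact ⟨Γ, h1, fun s hs => (segment_subset_trace hs).trans h2, h3,
    fun z hz => index_eq_zero_of_integrals_vanish h4 hz⟩

namespace Surrounds
variable {Γ Δ : Chain} {K K' U V : Set ℂ}

lemma trace_subset (h : Surrounds Γ K U) : trace Γ ⊆ U \ K := by
  rintro w ⟨s, hs, hw⟩
  exact h.subset s hs hw

lemma hull_subset (h : Surrounds Γ K U) : hull Γ ⊆ U :=
  HolFC.hull_subset (fun _ hw => (h.trace_subset hw).1) h.index_eq_zero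

lemma subset_hull (h : Surrounds Γ K U) : K ⊆ hull Γ := fun z hz => Or.inr (by
  simp [h.index_eq_one z hz])

lemma mono_left (h : Surrounds Γ K U) (hK : K' ⊆ K) : Surrounds Γ K' U :=
  ⟨h.isCycle, fun s hs => (h.subset s hs).trans (sdiff_subset_sdiff_right hK),
    fun z hz => h.index_eq_one z (hK hz), h.index_eq_zero⟩

/-- Only the hull of Γ matters for the ambient set, so `V` may be larger than `U` or a smaller set
such as `U` with points removed. -/
lemma mono_right (h : Surrounds Γ K U) (hV : hull Γ ⊆ V) : Surrounds Γ K V :=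
  ⟨h.isCycle, fun s hs _ hw => ⟨hV (Or.inl (segment_subset_trace hs hw)), (h.subset s hs hw).2⟩,
    h.index_eq_one, fun _ hz => index_eq_zero_of_notMem_hull fun h' => hz (hV h')⟩

lemma exists_outer (h : Surrounds Γ K U) (hU : IsOpen U) : ∃ Δ, Surrounds Δ (hull Γ) U :=
  exists_surrounds (isCompact_hull h.isCycle) hU h.hull_subset

lemma cauchy (h : Surrounds Γ K U) (hU : IsOpen U) {g : ℂ → E} (hg : DifferentiableOn ℂ g U) :
    chainIntegral g Γ = 0 :=
  chainIntegral_eq_zero h.isCycle hU (fun _ hw => (h.trace_subset hw).1) h.index_eq_zero hg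

/-- Cauchy's integral formula. -/
lemma cauchy_formula (h : Surrounds Γ K U) (hU : IsOpen U) {g : ℂ → ℂ}
    (hg : DifferentiableOn ℂ g U) {z : ℂ} (hzU : z ∈ U) (hz : z ∈ K) :
    chainIntegral (fun w => (w - z)⁻¹ * g w) Γ = 2 * (Real.pi : ℂ) * Complex.I * g z := by
  rw [chainIntegral_inv_sub_mul hU (fun _ hw => (h.trace_subset hw).1)
    (fun _ hg => h.cauchy hU hg) hg hzU fun hw => (h.trace_subset hw).2 hz, h.index_eq_one z hz,
    mul_one]

/-- Cauchy's theorem in `U \ K` applies to Γ followed by the reverse of Δ: the indices cancel on `K`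
and vanish outside `U`. -/
lemma chainIntegral_eq (h : Surrounds Γ K U) (h' : Surrounds Δ K U) (hU : IsOpen U)
    (hK : IsClosed K) {g : ℂ → E} (hg : DifferentiableOn ℂ g (U \ K)) :
    chainIntegral g Γ = chainIntegral g Δ := by
  rw [← sub_eq_zero, sub_eq_add_neg, ← chainIntegral_rev, ← chainIntegral_append]
  refine chainIntegral_eq_zero (IsCycle.append h.isCycle (IsCycle.rev h'.isCycle))
    (hU.sdiff hK) ?_ (fun z hz => ?_) hg
  · rw [trace_append, trace_rev]
    exact union_subset h.trace_subset h'.trace_subset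
  · rw [index_append, index_rev]
    by_cases hzU : z ∈ U
    · have hzK : z ∈ K := by_contra fun h => hz ⟨hzU, h⟩
      rw [h.index_eq_one z hzK, h'.index_eq_one z hzK, add_neg_cancel]
    · rw [h.index_eq_zero z hzU, h'.index_eq_zero z hzU, neg_zero, add_zero]

end Surrounds
end Cauchy

/-! ### The holomorphic functional calculus in a Banach algebra -/

section Calculus
variable {𝔸 : Type*} [NormedRing 𝔸] [NormedAlgebra ℂ 𝔸] [CompleteSpace 𝔸]

lemma sub_mul_resolvent {𝔸 : Type*} [NormedRing 𝔸] [NormedAlgebra ℂ 𝔸] {a : 𝔸} {z : ℂ} (hz : z ∉ spectrum ℂ a) :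
    (algebraMap ℂ 𝔸 z - a) * resolvent a z = 1 :=
  Ring.mul_inverse_cancel _ (spectrum.notMem_iff.mp hz)

lemma resolvent_mul_sub {𝔸 : Type*} [NormedRing 𝔸] [NormedAlgebra ℂ 𝔸] {a : 𝔸} {z : ℂ} (hz : z ∉ spectrum ℂ a) :
    resolvent a z * (algebraMap ℂ 𝔸 z - a) = 1 :=
  Ring.inverse_mul_cancel _ (spectrum.notMem_iff.mp hz)

lemma resolvent_sub_resolvent {𝔸 : Type*} [NormedRing 𝔸] [NormedAlgebra ℂ 𝔸]
    {a : 𝔸} {z w : ℂ} (hz : z ∉ spectrum ℂ a) (hw : w ∉ spectrum ℂ a) :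
    resolvent a z - resolvent a w = (w - z) • (resolvent a z * resolvent a w) := by
  calc resolvent a z - resolvent a w
      = resolvent a z * ((algebraMap ℂ 𝔸 w - a) * resolvent a w) -
        (resolvent a z * (algebraMap ℂ 𝔸 z - a)) * resolvent a w := by
        rw [sub_mul_resolvent hw, resolvent_mul_sub hz, mul_one, one_mul]
    _ = resolvent a z * (algebraMap ℂ 𝔸 w - algebraMap ℂ 𝔸 z) * resolvent a w := by
        noncomm_ring
    _ = (w - z) • (resolvent a z * resolvent a w) := by
        rw [← map_sub, Algebra.algebraMap_eq_smul_one, mul_smul_comm, mul_one, smul_mul_assoc]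

lemma differentiableOn_resolvent (a : 𝔸) : DifferentiableOn ℂ (resolvent a) (spectrum ℂ a)ᶜ :=
  fun _ hz => (spectrum.hasDerivAt_resolvent_const_left (not_not.mp hz)).differentiableAt.differentiableWithinAt

lemma resolvent_eq_inv_smul {𝔸 : Type*} [NormedRing 𝔸] [NormedAlgebra ℂ 𝔸]
    {a : 𝔸} {z : ℂ} (hz : z ∉ spectrum ℂ a) (h0 : z ≠ 0) :
    resolvent a z - z⁻¹ • 1 = z⁻¹ • (a * resolvent a z) := by
  have h := sub_mul_resolvent hz
  rw [sub_mul, sub_eq_iff_eq_add, Algebra.algebraMap_eq_smul_one, smul_mul_assoc, one_mul] at h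
  rw [sub_eq_iff_eq_add, ← smul_add, add_comm, ← h, inv_smul_smul₀ h0]

/-- The Cauchy integral of the holomorphic functional calculus in a Banach algebra. -/
noncomputable def holInt (f : ℂ → ℂ) (a : 𝔸) (Γ : Chain) : 𝔸 :=
  (2 * (Real.pi : ℂ) * Complex.I)⁻¹ • chainIntegral (fun z => f z • resolvent a z) Γ

variable {a : 𝔸} {U : Set ℂ} {Γ : Chain} {f g : ℂ → ℂ}

lemma Surrounds.continuousOn_resolvent (hΓ : Surrounds Γ (spectrum ℂ a) U) :
    ContinuousOn (resolvent a) (trace Γ) :=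
  (differentiableOn_resolvent a).continuousOn.mono fun _ hw => (hΓ.trace_subset hw).2

lemma Surrounds.continuousOn_smul_resolvent (hΓ : Surrounds Γ (spectrum ℂ a) U)
    (hf : ContinuousOn f (trace Γ)) :
    ContinuousOn (fun z => f z • resolvent a z) (trace Γ) :=
  hf.smul hΓ.continuousOn_resolvent

lemma chainIntegral_mul_const {F : ℂ → 𝔸} (hF : ContinuousOn F (trace Γ)) (b : 𝔸) :
    chainIntegral (fun z => F z * b) Γ = chainIntegral F Γ * b :=
  chainIntegral_clm ((ContinuousLinearMap.mul ℂ 𝔸).flip b) hF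

lemma chainIntegral_const_mul {F : ℂ → 𝔸} (hF : ContinuousOn F (trace Γ)) (b : 𝔸) :
    chainIntegral (fun z => b * F z) Γ = b * chainIntegral F Γ :=
  chainIntegral_clm (ContinuousLinearMap.mul ℂ 𝔸 b) hF

lemma commute_chainIntegral {F : ℂ → 𝔸} (hF : ContinuousOn F (trace Γ)) {b : 𝔸}
    (h : ∀ z ∈ trace Γ, Commute b (F z)) : Commute b (chainIntegral F Γ) := by
  rw [Commute, SemiconjBy, ← chainIntegral_const_mul hF, ← chainIntegral_mul_const hF]
  exact chainIntegral_congr fun z hz => h z hz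

/-- The holomorphic functional calculus is multiplicative. -/
theorem holInt_mul (hΓ : Surrounds Γ (spectrum ℂ a) U) (hU : IsOpen U)
    (hf : DifferentiableOn ℂ f U) (hg : DifferentiableOn ℂ g U) :
    holInt f a Γ * holInt g a Γ = holInt (fun z => f z * g z) a Γ := by
  -- Moving the second factor to an outer contour makes the traces disjoint. The resolvent identity
  -- then splits the product into two double integrals: `h1` gives the result by Cauchy's formula,
  -- `h2` vanishes.
  obtain ⟨Δ, hΔ⟩ := hΓ.exists_outer hU
  have hΔ' : Surrounds Δ (spectrum ℂ a) U := hΔ.mono_left hΓ.subset_hull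
  have hdisj : Disjoint (trace Γ) (trace Δ) :=
    disjoint_left.mpr fun w hw hw' => (hΔ.trace_subset hw').2 (trace_subset_hull Γ hw)
  have hgΔ : holInt g a Γ = holInt g a Δ := by
    rw [holInt, holInt, hΓ.chainIntegral_eq hΔ' hU (spectrum.isClosed a)]
    exact (hg.mono sdiff_subset).smul ((differentiableOn_resolvent a).mono fun _ h => h.2)
  have hΓU : trace Γ ⊆ U := fun _ hw => (hΓ.trace_subset hw).1
  have hΔU : trace Δ ⊆ U := fun _ hw => (hΔ.trace_subset hw).1
  have cfΓ := hf.continuousOn.mono hΓU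
  have cgΔ := hg.continuousOn.mono hΔU
  have cF := hΓ.continuousOn_smul_resolvent cfΓ
  have cG := hΔ'.continuousOn_smul_resolvent cgΔ
  have c1 : ContinuousOn (Function.uncurry fun z w : ℂ =>
      ((w - z)⁻¹ * g w) • (f z • resolvent a z)) (trace Γ ×ˢ trace Δ) :=
    ((continuousOn_inv_sub_prod hdisj).mul (cgΔ.comp continuousOn_snd fun _ hp => hp.2)).smul
      (cF.comp continuousOn_fst fun _ hp => hp.1)
  have c2 : ContinuousOn (Function.uncurry fun z w : ℂ =>
      ((w - z)⁻¹ * f z) • (g w • resolvent a w)) (trace Γ ×ˢ trace Δ) :=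
    ((continuousOn_inv_sub_prod hdisj).mul (cfΓ.comp continuousOn_fst fun _ hp => hp.1)).smul
      (cG.comp continuousOn_snd fun _ hp => hp.2)
  have slice : ∀ {F : ℂ → ℂ → 𝔸}, ContinuousOn (Function.uncurry F) (trace Γ ×ˢ trace Δ) →
      ∀ z ∈ trace Γ, ContinuousOn (F z) (trace Δ) := fun h z hz =>
    h.comp (f := fun w => (z, w)) (by fun_prop) fun w hw => ⟨hz, hw⟩
  have h1 : chainIntegral (fun z => chainIntegral (fun w =>
      ((w - z)⁻¹ * g w) • (f z • resolvent a z)) Δ) Γ =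
      (2 * (Real.pi : ℂ) * Complex.I) •
        chainIntegral (fun z => (f z * g z) • resolvent a z) Γ := by
    rw [← chainIntegral_smul]
    refine chainIntegral_congr fun z hz => ?_
    have hzΔ : z ∉ trace Δ := disjoint_left.mp hdisj hz
    rw [chainIntegral_smul_const ((continuousOn_inv_sub hzΔ).fun_mul cgΔ),
      hΔ.cauchy_formula hU hg (hΓU hz) (trace_subset_hull Γ hz)]
    simp only [smul_smul]
    congr 1
    ring
  have h2 : chainIntegral (fun z => chainIntegral (fun w =>
      ((w - z)⁻¹ * f z) • (g w • resolvent a w)) Δ) Γ = 0 := by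
    rw [chainIntegral_comm c2, chainIntegral_congr (g := fun _ => (0 : ℂ) • (0 : 𝔸)),
      chainIntegral_smul, zero_smul]
    intro w hw
    have hwΓ : w ∉ hull Γ := (hΔ.trace_subset hw).2
    -- Since w is outside `hull Γ`, removing it from `U` removes the pole and keeps Γ a surrounding
    -- contour.
    have hd : DifferentiableOn ℂ (fun z => (w - z)⁻¹ * f z) (U \ {w}) :=
      DifferentiableOn.mul (DifferentiableOn.inv (by fun_prop) fun z hz h =>
        hz.2 (sub_eq_zero.mp h).symm) (hf.mono sdiff_subset)
    have hs : Surrounds Γ (spectrum ℂ a) (U \ {w}) :=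
      hΓ.mono_right fun z hz => ⟨hΓ.hull_subset hz, fun h => hwΓ (h ▸ hz)⟩
    beta_reduce
    rw [chainIntegral_smul_const (hd.continuousOn.mono fun z hz => (hs.trace_subset hz).1),
      hs.cauchy (hU.sdiff isClosed_singleton) hd, zero_smul, zero_smul]
  have h3 : chainIntegral (fun z => f z • resolvent a z) Γ *
      chainIntegral (fun w => g w • resolvent a w) Δ =
      (2 * (Real.pi : ℂ) * Complex.I) •
        chainIntegral (fun z => (f z * g z) • resolvent a z) Γ := by
    rw [← chainIntegral_mul_const cF, ← h1]
    refine Eq.trans ?_ (sub_zero _)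
    rw [← h2, ← chainIntegral_sub (continuousOn_chainIntegral (isCompact_trace Γ) c1)
      (continuousOn_chainIntegral (isCompact_trace Γ) c2)]
    refine chainIntegral_congr fun z hz => ?_
    rw [← chainIntegral_const_mul cG, ← chainIntegral_sub (slice c1 z hz) (slice c2 z hz)]
    refine chainIntegral_congr fun w hw => ?_
    have hne : w - z ≠ 0 := fun h => disjoint_left.mp hdisj hz (sub_eq_zero.mp h ▸ hw)
    have hr := resolvent_sub_resolvent (hΓ.trace_subset hz).2 (hΔ'.trace_subset hw).2
    have hr' : resolvent a z * resolvent a w = (w - z)⁻¹ • (resolvent a z - resolvent a w) := by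
      rw [hr, inv_smul_smul₀ hne]
    rw [smul_mul_smul_comm, hr', smul_sub, smul_sub]
    simp only [smul_smul]
    congr 2 <;> ring
  rw [hgΔ, holInt, holInt, holInt, smul_mul_smul_comm, h3, mul_smul,
    inv_smul_smul₀ Complex.two_pi_I_ne_zero]

/-- A point of a side is (a + bi)u with a + b = 1, so its norm is at least ‖u‖/√2; the cruder 1/2
suffices. -/
lemma trace_square_norm_le {v w : ℂ} (hw : w ∈ trace (square 0 v)) : ‖v‖ / 2 ≤ ‖w‖ := by
  have key : ∀ u : ℂ, w ∈ segment ℝ u (Complex.I * u) → ‖u‖ / 2 ≤ ‖w‖ := by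
    rintro u ⟨a, b, ha, hb, hab, rfl⟩
    have h : a • u + b • (Complex.I * u) = (a + b * Complex.I) * u := by
      simp only [Complex.real_smul]; ring
    rw [h, norm_mul, div_eq_inv_mul]
    gcongr
    rw [Complex.norm_add_mul_I]
    refine Real.le_sqrt_of_sq_le ?_
    nlinarith [sq_nonneg (a - b)]
  obtain ⟨s, hs, hw⟩ := hw
  simp only [square, zero_add, zero_sub, List.mem_cons, List.not_mem_nil, or_false] at hs
  rcases hs with rfl | rfl | rfl | rfl
  · exact key v hw
  · simpa using key (Complex.I * v) (by simpa [← mul_assoc] using hw)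
  · simpa using key (-v) (by simpa using hw)
  · simpa using key (-(Complex.I * v)) (by simpa [← mul_assoc] using hw)

lemma index_square_of_norm_lt {v z : ℂ} (hz : ‖z‖ < ‖v‖ / 2) : index (square 0 v) z = 1 := by
  have hv : v ≠ 0 := by
    rintro rfl
    simp only [norm_zero, zero_div] at hz
    exact (norm_nonneg z).not_gt hz
  rw [← index_square_center 0 hv]
  refine index_eq_of_segment (isCycle_square 0 v) (disjoint_left.mpr fun w hw hw' => ?_)
  have h := (convex_ball (0 : ℂ) (‖v‖ / 2)).segment_subset (mem_ball_zero_iff.mpr hz)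
    (Metric.mem_ball_self ((norm_nonneg z).trans_lt hz)) hw
  exact (trace_square_norm_le hw').not_gt (mem_ball_zero_iff.mp h)

lemma norm_chainIntegral_square_le {E : Type*} [NormedAddCommGroup E] [NormedSpace ℂ E]
    {v : ℂ} {F : ℂ → E} {C : ℝ} (h : ∀ w ∈ trace (square 0 v), ‖F w‖ ≤ C) :
    ‖chainIntegral F (square 0 v)‖ ≤ 8 * ‖v‖ * C := by
  have hs : ∀ s ∈ square 0 v, ‖segIntegral F s‖ ≤ 2 * ‖v‖ * C := by
    intro s hs
    have hC : 0 ≤ C := (norm_nonneg _).trans (h s.1 ⟨s, hs, left_mem_segment ℝ _ _⟩)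
    refine (norm_segIntegral_le fun w hw => h w ⟨s, hs, hw⟩).trans ?_
    gcongr
    refine (norm_sub_le _ _).trans ?_
    simp only [square, zero_add, zero_sub, List.mem_cons, List.not_mem_nil, or_false] at hs
    rcases hs with rfl | rfl | rfl | rfl <;> simp [two_mul]
  simp only [square, List.mem_cons, List.not_mem_nil, or_false, forall_eq_or_imp, forall_eq] at hs
  obtain ⟨h1, h2, h3, h4⟩ := hs
  simp only [square, chainIntegral_cons, chainIntegral_nil, add_zero]
  refine (norm_add_le_of_le h1 (norm_add_le_of_le h2 (norm_add_le_of_le h3 h4))).trans ?_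
  linarith

/-- The contour is moved to a large square, where the resolvent differs from w⁻¹ by O(|w|⁻²). The
length grows only linearly, so the error tends to zero. -/
lemma chainIntegral_resolvent (hΓ : Surrounds Γ (spectrum ℂ a) U) :
    chainIntegral (resolvent a) Γ = (2 * (Real.pi : ℂ) * Complex.I) • (1 : 𝔸) := by
  obtain ⟨M, hM⟩ := (spectrum.resolvent_isBigO_inv (𝕜 := ℂ) a).bound
  obtain ⟨R, -, hR⟩ := (Metric.hasBasis_cobounded_compl_closedBall (0 : ℂ)).eventually_iff.mp hM
  obtain ⟨R', hR'⟩ := (spectrum.isBounded (𝕜 := ℂ) a).exists_norm_le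
  set D := chainIntegral (resolvent a) Γ - (2 * (Real.pi : ℂ) * Complex.I) • (1 : 𝔸) with hD
  -- The constant is 8t for the length bound times (2/t)‖a‖ · |M|(2/t) for the integrand.
  have bound : ∀ t : ℝ, 0 < t → R < t / 2 → R' < t / 2 → ‖D‖ ≤ 32 * ‖a‖ * |M| / t := by
    intro t ht htR htR'
    have hnorm : ‖(t : ℂ)‖ = t := by simp [ht.le]
    have htr : ∀ w ∈ trace (square 0 (t : ℂ)), t / 2 ≤ ‖w‖ := fun w hw =>
      hnorm ▸ trace_square_norm_le hw
    have hns : ∀ w ∈ trace (square 0 (t : ℂ)), w ∉ spectrum ℂ a := fun w hw h =>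
      ((hR' w h).trans_lt htR').not_ge (htr w hw)
    have h0t : ∀ w ∈ trace (square 0 (t : ℂ)), w ≠ 0 := fun w hw =>
      norm_pos_iff.mp ((half_pos ht).trans_le (htr w hw))
    have h0 : (0 : ℂ) ∉ trace (square 0 (t : ℂ)) := fun h => h0t 0 h rfl
    have hsq : Surrounds (square 0 (t : ℂ)) (spectrum ℂ a) univ :=
      ⟨isCycle_square _ _, fun s hs w hw => ⟨trivial, hns w (segment_subset_trace hs hw)⟩,
        fun z hz => index_square_of_norm_lt (by rw [hnorm]; exact (hR' z hz).trans_lt htR'),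
        fun z hz => (hz trivial).elim⟩
    have he : D = chainIntegral (fun w => resolvent a w - w⁻¹ • (1 : 𝔸)) (square 0 (t : ℂ)) := by
      have hi := continuousOn_inv_sub h0
      have hii := chainIntegral_inv_sub (square 0 (t : ℂ)) 0
      simp only [sub_zero] at hi hii
      rw [hD, chainIntegral_sub hsq.continuousOn_resolvent (hi.fun_smul continuousOn_const),
        chainIntegral_smul_const hi, hii, index_square_center _ (by simpa using ht.ne'), mul_one,
        (hΓ.mono_right (subset_univ _)).chainIntegral_eq hsq isOpen_univ (spectrum.isClosed a)]
      exact (differentiableOn_resolvent a).mono fun _ h => h.2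
    rw [he]
    refine (norm_chainIntegral_square_le (C := (t / 2)⁻¹ * (‖a‖ * (|M| * (t / 2)⁻¹)))
      fun w hw => ?_).trans (le_of_eq ?_)
    · rw [resolvent_eq_inv_smul (hns w hw) (h0t w hw), norm_smul, norm_inv]
      have hwt := htr w hw
      have h1 : ‖resolvent a w‖ ≤ |M| * (t / 2)⁻¹ := by
        refine (hR (x := w) (by simpa using htR.trans_le hwt)).trans ?_
        rw [norm_inv]
        gcongr
        exact le_abs_self M
      gcongr
      exact (norm_mul_le _ _).trans (by gcongr)
    · rw [hnorm]
      field_simp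
      ring
  have hlim : Filter.Tendsto (fun t : ℝ => 32 * ‖a‖ * |M| / t) Filter.atTop (nhds 0) :=
    Filter.Tendsto.div_atTop tendsto_const_nhds Filter.tendsto_id
  have h0 : ‖D‖ ≤ 0 := by
    refine ge_of_tendsto hlim ?_
    filter_upwards [Filter.eventually_gt_atTop 0, Filter.eventually_gt_atTop (2 * R),
      Filter.eventually_gt_atTop (2 * R')] with t h1 h2 h3
    exact bound t h1 (by linarith) (by linarith)
  exact sub_eq_zero.mp (norm_le_zero_iff.mp h0)

lemma holInt_const (hΓ : Surrounds Γ (spectrum ℂ a) U) (c : ℂ) :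
    holInt (fun _ => c) a Γ = algebraMap ℂ 𝔸 c := by
  rw [holInt, chainIntegral_smul, chainIntegral_resolvent hΓ, smul_comm,
    inv_smul_smul₀ Complex.two_pi_I_ne_zero, Algebra.algebraMap_eq_smul_one]

lemma holInt_sub (hΓ : Surrounds Γ (spectrum ℂ a) U) (hf : ContinuousOn f (trace Γ))
    (hg : ContinuousOn g (trace Γ)) :
    holInt (fun z => f z - g z) a Γ = holInt f a Γ - holInt g a Γ := by
  simp only [holInt, sub_smul]
  rw [chainIntegral_sub (hΓ.continuousOn_smul_resolvent hf) (hΓ.continuousOn_smul_resolvent hg),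
    smul_sub]

/-- On the contour z R(z) = a R(z) + 1, and the constant term integrates to zero. -/
lemma holInt_id (hΓ : Surrounds Γ (spectrum ℂ a) U) : holInt (fun z => z) a Γ = a := by
  have h : EqOn (fun z => z • resolvent a z) (fun z => a * resolvent a z + 1) (trace Γ) := by
    intro z hz
    have h := sub_mul_resolvent (hΓ.trace_subset hz).2
    rw [sub_mul, sub_eq_iff_eq_add', Algebra.algebraMap_eq_smul_one, smul_mul_assoc, one_mul] at h
    exact h
  have h1 : chainIntegral (fun _ => (1 : 𝔸)) Γ = 0 :=
    (hΓ.mono_right (subset_univ _)).cauchy isOpen_univ (differentiableOn_const 1)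
  rw [holInt, chainIntegral_congr h, chainIntegral_add
    (continuousOn_const.fun_mul hΓ.continuousOn_resolvent) continuousOn_const, h1, add_zero,
    chainIntegral_const_mul hΓ.continuousOn_resolvent, chainIntegral_resolvent hΓ, mul_smul_comm,
    mul_one, inv_smul_smul₀ Complex.two_pi_I_ne_zero]

lemma commute_of_mul_eq_one {M : Type*} [Monoid M] {x y b : M} (hxy : x * y = 1) (hyx : y * x = 1) (h : Commute b x) :
    Commute b y :=
  Commute.units_inv_right (u := ⟨x, y, hxy, hyx⟩) h

lemma commute_holInt (hΓ : Surrounds Γ (spectrum ℂ a) U) (hf : ContinuousOn f (trace Γ)) {b : 𝔸}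
    (h : Commute b a) : Commute b (holInt f a Γ) := by
  refine (commute_chainIntegral (hΓ.continuousOn_smul_resolvent hf) fun z hz => ?_).smul_right _
  refine Commute.smul_right ?_ _
  exact commute_of_mul_eq_one (sub_mul_resolvent (hΓ.trace_subset hz).2)
    (resolvent_mul_sub (hΓ.trace_subset hz).2) ((Algebra.commute_algebraMap_right z b).sub_right h)

end Calculus

/-! ### Injective functions: recovering `a` from `f(a)` -/

section Injective

/-- The derivative of an injective holomorphic function does not vanish. -/
theorem deriv_ne_zero_of_injOn {f : ℂ → ℂ} {U : Set ℂ} (hU : IsOpen U)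
    (hf : DifferentiableOn ℂ f U) (hinj : InjOn f U) {z : ℂ} (hz : z ∈ U) : deriv f z ≠ 0 := by
  intro hd
  have hUz := hU.mem_nhds hz
  have hfa : AnalyticAt ℂ f z := hf.analyticAt hUz
  have hfa' : AnalyticAt ℂ (fun w => f w - f z) z := hfa.sub analyticAt_const
  have horder := hfa.analyticOrderAt_deriv_add_one
  have hd1 : analyticOrderAt (deriv f) z ≠ 0 := analyticOrderAt_ne_zero.mpr ⟨hfa.deriv, hd⟩
  have htop : analyticOrderAt (fun w => f w - f z) z ≠ ⊤ := by
    rw [Ne, analyticOrderAt_eq_top]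
    intro h
    obtain ⟨w, ⟨hw, hwU⟩, hne⟩ := (((h.and hUz).filter_mono nhdsWithin_le_nhds).and
      (self_mem_nhdsWithin (a := z) (s := {z}ᶜ))).exists
    exact hne (hinj hwU hz (sub_eq_zero.mp hw))
  obtain ⟨n, hn⟩ := ENat.ne_top_iff_exists.mp htop
  -- A zero of the derivative gives f - f(z) a zero of order at least two.
  have hn2 : 1 < n := by
    rw [← hn] at horder
    have hdtop : analyticOrderAt (deriv f) z ≠ ⊤ := fun h => by simp [h] at horder
    obtain ⟨m, hm⟩ := ENat.ne_top_iff_exists.mp hdtop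
    rw [← hm] at horder hd1
    norm_cast at horder hd1
    omega
  obtain ⟨g, hg, hg0, hfg⟩ := hfa'.analyticOrderAt_eq_natCast.mp hn.symm
  -- A local coordinate built from an n-th root of g / g(z), in which f - f(z) is g(z) hⁿ.
  set h : ℂ → ℂ := fun w => (w - z) * Complex.exp (Complex.log (g w / g z) / n) with hh
  have hn0 : (n : ℂ) ≠ 0 := by exact_mod_cast (by omega : n ≠ 0)
  have hh1 : HasStrictDerivAt h 1 z := by
    have hgs : g z / g z ∈ Complex.slitPlane := by simp [div_self hg0]
    have h1 := ((((hg.hasStrictDerivAt).div_const (g z)).clog hgs).div_const (n : ℂ)).cexp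
    have h2 := HasStrictDerivAt.fun_mul ((hasStrictDerivAt_id z).sub_const z) h1
    simpa [div_self hg0] using h2
  have hpow : ∀ᶠ w in nhds z, f w - f z = g z * h w ^ n := by
    filter_upwards [hfg, hg.continuousAt.eventually_ne hg0] with w hw hgw
    rw [hw, hh]
    simp only [smul_eq_mul]
    rw [mul_pow, ← Complex.exp_nat_mul, mul_div_cancel₀ _ hn0,
      Complex.exp_log (div_ne_zero hgw hg0)]
    field_simp
  have hmap := hh1.map_nhds_eq one_ne_zero
  have hz0 : h z = 0 := by simp [hh]
  rw [hz0] at hmap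
  have himg : h '' {w | w ∈ U ∧ f w - f z = g z * h w ^ n} ∈ nhds (0 : ℂ) := by
    rw [← hmap]
    exact Filter.image_mem_map ((Filter.eventually_of_mem hUz fun _ h => h).and hpow)
  -- The function hⁿ cannot distinguish the values e and ωe. Both are attained by `h` near z for
  -- small e ≠ 0, which contradicts injectivity.
  set ω := Complex.exp (2 * Real.pi * Complex.I / n)
  have hω : IsPrimitiveRoot ω n := Complex.isPrimitiveRoot_exp n (by omega)
  have himg' : ∀ᶠ e in nhds (0 : ℂ), ω * e ∈ h '' {w | w ∈ U ∧ f w - f z = g z * h w ^ n} := by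
    have hc : Continuous fun e : ℂ => ω * e := by fun_prop
    have ht : Filter.Tendsto (fun e : ℂ => ω * e) (nhds 0) (nhds 0) := by simpa using hc.tendsto 0
    exact ht himg
  obtain ⟨e, ⟨⟨w₁, ⟨hw₁, hf₁⟩, he₁⟩, w₂, ⟨hw₂, hf₂⟩, he₂⟩, hne⟩ :=
    (((Filter.Eventually.and himg himg').filter_mono nhdsWithin_le_nhds).and
      (self_mem_nhdsWithin (a := (0 : ℂ)) (s := {0}ᶜ))).exists
  have heq : f w₁ = f w₂ := by
    rw [← sub_left_inj (a := f z), hf₁, hf₂, he₁, he₂, mul_pow, hω.pow_eq_one, one_mul]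
  have hww := hinj hw₁ hw₂ heq
  rw [← hww, he₁] at he₂
  exact hω.ne_one hn2 (mul_right_cancel₀ hne (by rw [one_mul]; exact he₂.symm))

variable {𝔸 : Type*} [NormedRing 𝔸] [NormedAlgebra ℂ 𝔸] [CompleteSpace 𝔸]
  {a : 𝔸} {U : Set ℂ} {Γ : Chain} {f : ℂ → ℂ}

lemma holInt_congr {𝔸 : Type*} [NormedRing 𝔸] [NormedAlgebra ℂ 𝔸] {a : 𝔸} {g : ℂ → ℂ} (h : EqOn f g (trace Γ)) : holInt f a Γ = holInt g a Γ := by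
  rw [holInt, holInt, chainIntegral_congr]
  intro z hz
  simp only [h hz]

/-- An element that commutes with `f(a)` commutes with the inverse of `c - f(a)`. -/
lemma commute_holInt_inv (hΓ : Surrounds Γ (spectrum ℂ a) U) (hU : IsOpen U)
    (hf : DifferentiableOn ℂ f U) {c : ℂ} (hc : ∀ z ∈ U, c - f z ≠ 0) {b : 𝔸}
    (h : Commute b (holInt f a Γ)) : Commute b (holInt (fun z => (c - f z)⁻¹) a Γ) := by
  have hΓU : trace Γ ⊆ U := fun _ hw => (hΓ.trace_subset hw).1
  have hcf : DifferentiableOn ℂ (fun z => c - f z) U := hf.const_sub c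
  have h1 : holInt (fun z => c - f z) a Γ = algebraMap ℂ 𝔸 c - holInt f a Γ := by
    rw [holInt_sub hΓ continuousOn_const (hf.continuousOn.mono hΓU), holInt_const hΓ]
  have hone : holInt (fun _ => 1) a Γ = 1 := by rw [holInt_const hΓ, map_one]
  refine commute_of_mul_eq_one (x := holInt (fun z => c - f z) a Γ) ?_ ?_ ?_
  · rw [holInt_mul hΓ hU hcf (hcf.fun_inv hc), ← hone]
    exact holInt_congr fun z hz => mul_inv_cancel₀ (hc z (hΓU hz))
  · rw [holInt_mul hΓ hU (hcf.fun_inv hc) hcf, ← hone]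
    exact holInt_congr fun z hz => inv_mul_cancel₀ (hc z (hΓU hz))
  · rw [h1]
    exact (Algebra.commute_algebraMap_right c b).sub_right h

/-- If `f` is holomorphic and injective, then everything that commutes with `f(a)` commutes
with `a`. -/
theorem commute_of_commute_holInt (hΓ : Surrounds Γ (spectrum ℂ a) U) (hU : IsOpen U)
    (hf : DifferentiableOn ℂ f U) (hinj : InjOn f U) {b : 𝔸} (h : Commute b (holInt f a Γ)) :
    Commute b a := by
  obtain ⟨Δ, hΔ⟩ := hΓ.exists_outer hU
  -- With the trace of Δ removed, f(ζ) - f has no zeros for ζ on Δ, so its reciprocal is admissible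
  -- in the calculus along Γ.
  have hV : IsOpen (U \ trace Δ) := hU.sdiff (isClosed_trace Δ)
  have hs : Surrounds Γ (spectrum ℂ a) (U \ trace Δ) := hΓ.mono_right fun z hz =>
    ⟨hΓ.hull_subset hz, fun h => (hΔ.trace_subset h).2 hz⟩
  have hΓU : trace Γ ⊆ U := fun _ hw => (hΓ.trace_subset hw).1
  have hΔU : trace Δ ⊆ U := fun _ hw => (hΔ.trace_subset hw).1
  have hne : ∀ ζ ∈ trace Δ, ∀ z ∈ U \ trace Δ, f ζ - f z ≠ 0 := fun ζ hζ z hz h0 =>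
    hz.2 (hinj (hΔU hζ) hz.1 (sub_eq_zero.mp h0) ▸ hζ)
  have hdf : DifferentiableOn ℂ (deriv f) U := hf.deriv hU
  -- Lagrange's formula for the inverse function: the integrand is (ζ - z)⁻¹ times ζ f'(ζ) / `dslope
  -- f z ζ`, which is holomorphic on `U` and takes the value z at ζ = z.
  have inner : ∀ z ∈ trace Γ, chainIntegral (fun ζ => ζ * deriv f ζ * (f ζ - f z)⁻¹) Δ =
      2 * (Real.pi : ℂ) * Complex.I * z := by
    intro z hz
    have hzU := hΓU hz
    have hzΔ : z ∉ trace Δ := (hs.trace_subset hz).1.2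
    have hq0 : ∀ ζ ∈ U, dslope f z ζ ≠ 0 := by
      intro ζ hζ
      rcases eq_or_ne ζ z with rfl | hζz
      · rw [dslope_same]
        exact deriv_ne_zero_of_injOn hU hf hinj hζ
      · rw [dslope_of_ne _ hζz, slope_def_field]
        exact div_ne_zero (sub_ne_zero.mpr fun h => hζz (hinj hζ hzU h)) (sub_ne_zero.mpr hζz)
    have hg : DifferentiableOn ℂ (fun ζ => ζ * deriv f ζ * (dslope f z ζ)⁻¹) U :=
      (differentiableOn_id.mul hdf).mul
        (((Complex.differentiableOn_dslope (hU.mem_nhds hzU)).mpr hf).inv hq0)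
    have hC := hΔ.cauchy_formula hU hg hzU (trace_subset_hull Γ hz)
    rw [dslope_same, mul_inv_cancel_right₀ (deriv_ne_zero_of_injOn hU hf hinj hzU)] at hC
    rw [← hC]
    refine chainIntegral_congr fun ζ hζ => ?_
    have hζz : ζ ≠ z := fun h => hzΔ (h ▸ hζ)
    have h1 := sub_ne_zero.mpr hζz
    have h2 := hne ζ hζ z (hs.trace_subset hz).1
    simp only [dslope_of_ne _ hζz, slope_def_field]
    field_simp
  have cR := hΓ.continuousOn_resolvent
  have cf := hf.continuousOn.mono hΓU
  have cfΔ := hf.continuousOn.mono hΔU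
  have ck : ContinuousOn (fun ζ => ζ * deriv f ζ) (trace Δ) :=
    continuousOn_id.mul (hdf.continuousOn.mono hΔU)
  have cinv : ContinuousOn (fun p : ℂ × ℂ => (f p.1 - f p.2)⁻¹) (trace Δ ×ˢ trace Γ) :=
    ContinuousOn.inv₀ ((cfΔ.comp continuousOn_fst fun _ hp => hp.1).sub
      (cf.comp continuousOn_snd fun _ hp => hp.2))
      fun p hp => hne p.1 hp.1 p.2 (hs.trace_subset hp.2).1
  have cK : ContinuousOn (Function.uncurry fun ζ z : ℂ =>
      (ζ * deriv f ζ * (f ζ - f z)⁻¹) • resolvent a z) (trace Δ ×ˢ trace Γ) :=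
    ((ck.comp continuousOn_fst fun _ hp => hp.1).mul cinv).smul
      (cR.comp continuousOn_snd fun _ hp => hp.2)
  -- The inner integral is 2πi ζ f'(ζ) (f(ζ) - f(a))⁻¹, so this expresses `a` through resolvents of
  -- f(a).
  have key : chainIntegral (fun ζ => chainIntegral (fun z =>
      (ζ * deriv f ζ * (f ζ - f z)⁻¹) • resolvent a z) Γ) Δ =
      (2 * (Real.pi : ℂ) * Complex.I) • (2 * (Real.pi : ℂ) * Complex.I) • a := by
    conv_rhs => rw [← holInt_id hΓ]
    rw [chainIntegral_comm cK, holInt, smul_inv_smul₀ Complex.two_pi_I_ne_zero,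
      ← chainIntegral_smul]
    refine chainIntegral_congr fun z hz => ?_
    have cz : ContinuousOn (fun ζ => ζ * deriv f ζ * (f ζ - f z)⁻¹) (trace Δ) :=
      ck.mul (cinv.comp (f := fun ζ => (ζ, z)) (by fun_prop) fun ζ hζ => ⟨hζ, hz⟩)
    rw [chainIntegral_smul_const cz, inner z hz, mul_smul]
  have hcomm : Commute b ((2 * (Real.pi : ℂ) * Complex.I) • (2 * (Real.pi : ℂ) * Complex.I) • a) := by
    rw [← key]
    refine commute_chainIntegral (continuousOn_chainIntegral (isCompact_trace Δ) cK) fun ζ hζ => ?_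
    have h1 := commute_holInt_inv hs hV (hf.mono sdiff_subset) (hne ζ hζ) h
    have h2 := (h1.smul_right (2 * (Real.pi : ℂ) * Complex.I)).smul_right (ζ * deriv f ζ)
    rw [holInt, smul_inv_smul₀ Complex.two_pi_I_ne_zero, ← chainIntegral_smul] at h2
    simpa only [smul_smul] using h2
  have h3 := (hcomm.smul_right (2 * (Real.pi : ℂ) * Complex.I)⁻¹).smul_right
    (2 * (Real.pi : ℂ) * Complex.I)⁻¹
  rwa [inv_smul_smul₀ Complex.two_pi_I_ne_zero, inv_smul_smul₀ Complex.two_pi_I_ne_zero] at h3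

end Injective

/-! ### The exponential function -/

section Exponential

lemma hasSum_segIntegral {E : Type*} [NormedAddCommGroup E] [NormedSpace ℂ E] [CompleteSpace E]
    {F : ℕ → ℂ → E} {f : ℂ → E} {u : ℕ → ℝ} {s : ℂ × ℂ} (hu : Summable u)
    (hF : ∀ n, ContinuousOn (F n) (segment ℝ s.1 s.2))
    (hb : ∀ n, ∀ w ∈ segment ℝ s.1 s.2, ‖F n w‖ ≤ u n)
    (hs : ∀ w ∈ segment ℝ s.1 s.2, HasSum (fun n => F n w) (f w)) :
    HasSum (fun n => segIntegral (F n) s) (segIntegral f s) := by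
  unfold segIntegral
  have hmem : ∀ t ∈ Set.uIoc (0 : ℝ) 1, s.1 + (t : ℂ) * (s.2 - s.1) ∈ segment ℝ s.1 s.2 := by
    intro t ht
    rw [uIoc_of_le zero_le_one] at ht
    exact point_mem_segment s ⟨ht.1.le, ht.2⟩
  refine HasSum.const_smul _ (intervalIntegral.hasSum_integral_of_dominated_convergence
    (fun n _ => u n) (fun n => ?_) (fun n => ?_) ?_ ?_ ?_)
  · exact (intervalIntegrable_point (hF n)).def'.aestronglyMeasurable
  · exact Filter.Eventually.of_forall fun t ht => hb n _ (hmem t ht)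
  · exact Filter.Eventually.of_forall fun t _ => hu
  · exact intervalIntegrable_const
  · exact Filter.Eventually.of_forall fun t ht => hs _ (hmem t ht)

lemma hasSum_chainIntegral {E : Type*} [NormedAddCommGroup E] [NormedSpace ℂ E] [CompleteSpace E]
    {F : ℕ → ℂ → E} {f : ℂ → E} {u : ℕ → ℝ} {Γ : Chain} (hu : Summable u)
    (hF : ∀ n, ContinuousOn (F n) (trace Γ)) (hb : ∀ n, ∀ w ∈ trace Γ, ‖F n w‖ ≤ u n)
    (hs : ∀ w ∈ trace Γ, HasSum (fun n => F n w) (f w)) :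
    HasSum (fun n => chainIntegral (F n) Γ) (chainIntegral f Γ) := by
  induction Γ with
  | nil => simp [hasSum_zero]
  | cons s Γ ih =>
    rw [trace_cons] at hF hb hs
    simp only [chainIntegral_cons]
    exact (hasSum_segIntegral hu (fun n => (hF n).mono subset_union_left)
      (fun n w hw => hb n w (Or.inl hw)) fun w hw => hs w (Or.inl hw)).add
      (ih (fun n => (hF n).mono subset_union_right) (fun n w hw => hb n w (Or.inr hw))
        fun w hw => hs w (Or.inr hw))

variable {𝔸 : Type*} [NormedRing 𝔸] [NormedAlgebra ℂ 𝔸] [CompleteSpace 𝔸]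
  {a : 𝔸} {U : Set ℂ} {Γ : Chain}

lemma holInt_pow (hΓ : Surrounds Γ (spectrum ℂ a) U) (n : ℕ) :
    holInt (fun z => z ^ n) a Γ = a ^ n := by
  induction n with
  | zero => simpa using holInt_const hΓ 1
  | succ n ih =>
    have h := holInt_mul (hΓ.mono_right (subset_univ _)) isOpen_univ (f := fun z => z ^ n)
      (g := fun z => z) (by fun_prop) (by fun_prop)
    rw [ih, holInt_id hΓ] at h
    simpa only [pow_succ] using h.symm

/-- The functional calculus of the exponential function is the exponential series. -/
theorem holInt_exp (hΓ : Surrounds Γ (spectrum ℂ a) U) :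
    holInt Complex.exp a Γ = NormedSpace.exp a := by
  obtain ⟨R, hR⟩ := (isCompact_trace Γ).isBounded.exists_norm_le
  obtain ⟨M, hM⟩ := (isCompact_trace Γ).exists_bound_of_continuousOn hΓ.continuousOn_resolvent
  have hsum : HasSum (fun n : ℕ => chainIntegral (fun z =>
      ((n.factorial : ℂ)⁻¹ * z ^ n) • resolvent a z) Γ)
      (chainIntegral (fun z => Complex.exp z • resolvent a z) Γ) := by
    refine hasSum_chainIntegral (u := fun n => |R| ^ n / n.factorial * |M|)
      ((Real.summable_pow_div_factorial |R|).mul_right |M|) (fun n => ?_) (fun n w hw => ?_)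
      fun w hw => ?_
    · exact hΓ.continuousOn_smul_resolvent (by fun_prop)
    · rw [norm_smul, norm_mul, norm_inv, norm_pow, Complex.norm_natCast, div_eq_inv_mul]
      gcongr
      · exact (hR w hw).trans (le_abs_self R)
      · exact (hM w hw).trans (le_abs_self M)
    · have h := NormedSpace.expSeries_div_hasSum_exp (𝔸 := ℂ) w
      rw [← Complex.exp_eq_exp_ℂ] at h
      simpa only [div_eq_inv_mul] using h.smul_const (resolvent a w)
  have h2 := hsum.const_smul (2 * (Real.pi : ℂ) * Complex.I)⁻¹
  have h3 : ∀ n : ℕ, (2 * (Real.pi : ℂ) * Complex.I)⁻¹ • chainIntegral (fun z =>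
      ((n.factorial : ℂ)⁻¹ * z ^ n) • resolvent a z) Γ = (n.factorial : ℂ)⁻¹ • a ^ n := by
    intro n
    simp only [mul_smul]
    rw [chainIntegral_smul, smul_comm, ← holInt_pow hΓ, holInt]
  simp only [h3] at h2
  rw [NormedSpace.exp_eq_tsum ℂ]
  exact h2.tsum_eq.symm

/-- Congruence freeness makes `exp` injective on `K`, and the inverse function theorem makes it
injective near each point. For compact `K` the two together give injectivity on a neighbourhood. -/
lemma exists_isOpen_injOn_exp {K : Set ℂ} (hK : IsCompact K)
    (h : CongruenceFree (2 * (Real.pi : ℂ) * Complex.I) K) :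
    ∃ U, IsOpen U ∧ K ⊆ U ∧ InjOn Complex.exp U := by
  refine InjOn.exists_isOpen_superset (fun z hz w hw hzw => ?_) hK
    (fun z _ => Complex.continuous_exp.continuousAt) fun z _ => ?_
  · by_contra hne
    obtain ⟨n, hn⟩ := Complex.exp_eq_exp_iff_exists_int.mp hzw
    exact h z hz w hw hne n (by rw [hn]; ring)
  · have hd := (Complex.hasStrictDerivAt_exp z).hasStrictFDerivAt_equiv (Complex.exp_ne_zero z)
    exact ⟨_, (HasStrictFDerivAt.toOpenPartialHomeomorph Complex.exp hd).open_source.mem_nhds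
      (HasStrictFDerivAt.mem_toOpenPartialHomeomorph_source hd),
      (HasStrictFDerivAt.toOpenPartialHomeomorph Complex.exp hd).injOn⟩

end Exponential

/-! ### Commutants and the main theorem -/

lemma exists_holFC_eq {X : Type*} [NormedAddCommGroup X] [NormedSpace ℂ X] [CompleteSpace X]
    (A : X →L[ℂ] X) (f : ℂ → ℂ) {U : Set ℂ} (hU : IsOpen U) (hA : spectrum ℂ A ⊆ U) :
    ∃ Γ, Surrounds Γ (spectrum ℂ A) U ∧ holFC f U A = holInt f A Γ := by
  have h := exists_surrounds (spectrum.isCompact (𝕜 := ℂ) A) hU hA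
  exact ⟨h.choose, h.choose_spec, dif_pos h⟩

/-- The commutant of `f(a)` is the commutant of `a` when `f` is holomorphic and injective. -/
lemma commute_holInt_iff {𝔸 : Type*} [NormedRing 𝔸] [NormedAlgebra ℂ 𝔸] [CompleteSpace 𝔸]
    {a : 𝔸} {U : Set ℂ} {Γ : Chain} {f : ℂ → ℂ} (hΓ : Surrounds Γ (spectrum ℂ a) U)
    (hU : IsOpen U) (hf : DifferentiableOn ℂ f U) (hinj : InjOn f U) {b : 𝔸} :
    Commute (holInt f a Γ) b ↔ Commute a b :=
  ⟨fun h => (commute_of_commute_holInt hΓ hU hf hinj h.symm).symm, fun h =>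
    (commute_holInt hΓ (hf.continuousOn.mono fun _ hz => (hΓ.trace_subset hz).1) h.symm).symm⟩

end HolFC

theorem mainTheorem12 {X : Type*} [NormedAddCommGroup X] [NormedSpace ℂ X] [CompleteSpace X] :
    (∀ (A B : X →L[ℂ] X) (f g : ℂ → ℂ) (U_A U_B : Set ℂ),
      IsOpen U_A → IsOpen U_B → spectrum ℂ A ⊆ U_A → spectrum ℂ B ⊆ U_B →
      DifferentiableOn ℂ f U_A → Set.InjOn f U_A →
      DifferentiableOn ℂ g U_B → Set.InjOn g U_B →
      (⁅HolFC.holFC f U_A A, HolFC.holFC g U_B B⁆ = 0 ↔ ⁅A, B⁆ = 0)) ∧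
    (∀ A B : X →L[ℂ] X,
      HolFC.CongruenceFree (2 * (Real.pi : ℂ) * Complex.I) (spectrum ℂ A) →
      (⁅NormedSpace.exp A, B⁆ = 0 ↔ ⁅A, B⁆ = 0)) := by
  constructor
  · intro A B f g U V hU hV hA hB hf hfi hg hgi
    obtain ⟨Γ, hΓ, hfA⟩ := HolFC.exists_holFC_eq A f hU hA
    obtain ⟨Δ, hΔ, hgB⟩ := HolFC.exists_holFC_eq B g hV hB
    rw [← commute_iff_lie_eq, ← commute_iff_lie_eq, hfA, hgB,
      HolFC.commute_holInt_iff hΓ hU hf hfi, Commute.symm_iff,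
      HolFC.commute_holInt_iff hΔ hV hg hgi, Commute.symm_iff]
  · intro A B hA
    -- The neighbourhood of injectivity plays the role of `U_A`, with `f` the exponential.
    obtain ⟨U, hU, hAU, hinj⟩ := HolFC.exists_isOpen_injOn_exp (spectrum.isCompact A) hA
    obtain ⟨Γ, hΓ⟩ := HolFC.exists_surrounds (spectrum.isCompact (𝕜 := ℂ) A) hU hAU
    rw [← commute_iff_lie_eq, ← commute_iff_lie_eq, ← HolFC.holInt_exp hΓ,
      HolFC.commute_holInt_iff hΓ hU Complex.differentiable_exp.differentiableOn hinj]
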